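/- Let $\mathbb F$ be a field. For a finite ranked poset $P$, let $E_P$ be the set of edges $(q,p)$ of its Hasse diagram ($q$ covers $p$), each directed from its tail $q$ to its head $p$. To a path $\pi=(e_1,\dots,e_m)$, $m\ge 1$ (the head of $e_i$ is the tail of $e_{i+1}$), associate the polynomial $p_\pi(t)=(t-e_1)(t-e_2)\cdots(t-e_m)=\sum_k e(\pi,k)t^k$ over the free algebra $\mathbb F\langle E_P\rangle$, with $t$ central. The splitting algebra $A(P)$ is the quotient of $\mathbb F\langle E_P\rangle$ by the two-sided ideal generated by all $e(\pi_1,k)-e(\pi_2,k)$, where $k\ge 0$ and $\pi_1,\pi_2$ are paths with the same starting vertex and the same final vertex. It inherits a grading $A(P)=\bigoplus_{i\ge 0}A(P)_i$ from $\mathbb F\langle E_P\rangle$ (edges have degree $1$), and an automorphism $\sigma$ of $P$ induces a graded algebra automorphism of $A(P)$, given by $(q,p)\mapsto(\sigma q,\sigma p)$ on edges and also denoted $\sigma$. Put $$Tr_\sigma(A(P),z)=\sum_{i\ge 0}Tr\left(\sigma|_{A(P)_i}\right)z^i\in\mathbb F[[z]].$$ Proposition. Let $n\ge 0$, let $2^{[n]}$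 be the lattice of subsets of $[n]=\{1,\dots,n\}$, and let $\sigma$ be an automorphism of $2^{[n]}$. Let $i_1,\dots,i_r$ be the lengths of the cycles of the permutation of the $n$ single-element sets given by $\sigma$, where fixed points count as cycles of length $1$ (so $i_1+\cdots+i_r=n$). Then $$Tr_\sigma(A(2^{[n]}),z)=\frac{1-z}{1-z\prod_{j=1}^r\left(2-z^{i_j}\right)}.$$ -/

import Mathlib

open scoped DirectSum PowerSeries

noncomputable section

/-- An edge of the Hasse diagram of `P`: a pair `(tail, head)` with `head ⋖ tail`. -/
@[ext] structure HasseEdge (P : Type*) [PartialOrder P] where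
  tail : P
  head : P
  covBy : head ⋖ tail

/-- A path in the Hasse diagram: a nonempty tuple of edges, each one starting where the
previous one ends. -/
structure HassePath (P : Type*) [PartialOrder P] where
  edges : List (HasseEdge P)
  ne_nil : edges ≠ []
  isChain : edges.IsChain (fun e f => e.head = f.tail)

namespace HassePath

variable {P : Type*} [PartialOrder P]

/-- The starting vertex `t(π)`. -/
def tail (π : HassePath P) : P := (π.edges.head π.ne_nil).tail

/-- The final vertex `h(π)`. -/
def head (π : HassePath P) : P := (π.edges.getLast π.ne_nil).head

/-- Two paths are equivalent if they have the same tail and the same head. -/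
def Equivalent (π₁ π₂ : HassePath P) : Prop := π₁.tail = π₂.tail ∧ π₁.head = π₂.head

end HassePath

open Polynomial in
/-- The polynomial `(t - e₁)(t - e₂)⋯(t - eₘ)` over the free algebra on the edges of the Hasse
diagram; the variable `t` is central. -/
def pathPoly (F : Type*) [Field F] {P : Type*} [PartialOrder P] (l : List (HasseEdge P)) :
    Polynomial (FreeAlgebra F (HasseEdge P)) :=
  (l.map fun e => (X : Polynomial (FreeAlgebra F (HasseEdge P))) - C (FreeAlgebra.ι F e)).prod

/-- The defining relations of the splitting algebra: for equivalent paths, the polynomials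
attached to them have the same coefficients. -/
inductive SplittingRel (F : Type*) [Field F] (P : Type*) [PartialOrder P] :
    FreeAlgebra F (HasseEdge P) → FreeAlgebra F (HasseEdge P) → Prop
  | coeff_eq (π₁ π₂ : HassePath P) (h : π₁.Equivalent π₂) (k : ℕ) :
      SplittingRel F P ((pathPoly F π₁.edges).coeff k) ((pathPoly F π₂.edges).coeff k)

/-- The splitting algebra `A(P)`: the free algebra on the edges of the Hasse diagram, modulo the
two-sided ideal generated by the relations. -/
abbrev SplittingAlgebra (F : Type*) [Field F] (P : Type*) [PartialOrder P] : Type _ :=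
  RingQuot (SplittingRel F P)

/-- The graded trace generating function `∑ Tr(σ|_{A_i}) zⁱ` of a graded automorphism `σ` of a
graded algebra `A = ⨁ A_i` (with finite-dimensional pieces). -/
def gradedTrace {F A : Type*} [Field F] [Ring A] [Algebra F A] (𝒜 : ℕ → Submodule F A)
    [GradedAlgebra 𝒜] (σ : A ≃ₐ[F] A) (hσ : ∀ i, ∀ a ∈ 𝒜 i, σ a ∈ 𝒜 i) : F⟦X⟧ :=
  PowerSeries.mk fun i => LinearMap.trace F (𝒜 i) (σ.toLinearMap.restrict (hσ i))

/-! ### Action of poset automorphisms -/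

section Action

variable {P : Type*} [PartialOrder P]

/-- The action of an automorphism of `P` on the edges of the Hasse diagram. -/
def HasseEdge.map (σ : P ≃o P) (e : HasseEdge P) : HasseEdge P :=
  ⟨σ e.tail, σ e.head, (apply_covBy_apply_iff σ).2 e.covBy⟩

/-- The action of an automorphism of `P` on paths. -/
def HassePath.map (σ : P ≃o P) (π : HassePath P) : HassePath P where
  edges := π.edges.map (HasseEdge.map σ)
  ne_nil := by simpa using π.ne_nil
  isChain := by
    rw [List.isChain_map]
    exact π.isChain.imp fun e f h => by simp [HasseEdge.map, h]

theorem HassePath.Equivalent.map (σ : P ≃o P) {π₁ π₂ : HassePath P} (h : π₁.Equivalent π₂) :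
    (π₁.map σ).Equivalent (π₂.map σ) := by
  obtain ⟨h₁, h₂⟩ := h
  simp only [HassePath.tail, HassePath.head] at h₁ h₂
  constructor
  · simp [HassePath.tail, HassePath.map, HasseEdge.map, h₁]
  · simp [HassePath.head, HassePath.map, HasseEdge.map, h₂]

variable (F : Type*) [Field F]

theorem coeff_pathPoly_map (σ : P ≃o P) (l : List (HasseEdge P)) (k : ℕ) :
    FreeAlgebra.lift F (fun e => FreeAlgebra.ι F (HasseEdge.map σ e)) ((pathPoly F l).coeff k)
      = (pathPoly F (l.map (HasseEdge.map σ))).coeff k := by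
  have h : ((pathPoly F l).map (FreeAlgebra.lift F
      (fun e => FreeAlgebra.ι F (HasseEdge.map σ e)) :
        FreeAlgebra F (HasseEdge P) →ₐ[F] FreeAlgebra F (HasseEdge P)).toRingHom)
      = pathPoly F (l.map (HasseEdge.map σ)) := by
    induction l with
    | nil => simp [pathPoly]
    | cons e l ih =>
      simp only [pathPoly, List.map_cons, List.prod_cons, Polynomial.map_mul] at ih ⊢
      rw [ih]
      simp
  rw [← h, Polynomial.coeff_map]
  rfl

namespace SplittingAlgebra

/-- The class of an edge in `A(P)`. -/
def edge (e : HasseEdge P) : SplittingAlgebra F P :=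
  RingQuot.mkAlgHom F (SplittingRel F P) (FreeAlgebra.ι F e)

variable {F} in
theorem algHom_ext {B : Type*} [Semiring B] [Algebra F B]
    {f g : SplittingAlgebra F P →ₐ[F] B} (h : ∀ e, f (edge F e) = g (edge F e)) : f = g := by
  apply RingQuot.ringQuot_ext'
  apply FreeAlgebra.hom_ext
  funext e
  exact h e

/-- The algebra endomorphism induced by `e ↦ σ e`. -/
def mapHom (σ : P ≃o P) : SplittingAlgebra F P →ₐ[F] SplittingAlgebra F P :=
  RingQuot.liftAlgHom F ⟨(RingQuot.mkAlgHom F (SplittingRel F P)).comp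
    (FreeAlgebra.lift F (fun e => FreeAlgebra.ι F (HasseEdge.map σ e))), by
      rintro _ _ ⟨π₁, π₂, h, k⟩
      simp only [AlgHom.comp_apply, coeff_pathPoly_map]
      exact RingQuot.mkAlgHom_rel F (SplittingRel.coeff_eq _ _ (h.map σ) k)⟩

@[simp] theorem mapHom_edge (σ : P ≃o P) (e : HasseEdge P) :
    mapHom F σ (edge F e) = edge F (e.map σ) := by
  simp [mapHom, edge]

/-- The algebra automorphism of `A(P)` induced by an automorphism `σ` of the poset `P`. -/
def mapEquiv (σ : P ≃o P) : SplittingAlgebra F P ≃ₐ[F] SplittingAlgebra F P :=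
  AlgEquiv.ofAlgHom (mapHom F σ) (mapHom F σ.symm)
    (algHom_ext fun e => by simp [HasseEdge.map]) (algHom_ext fun e => by simp [HasseEdge.map])

/-- The degree `i` part of `A(P)`: the image of the degree `i` part of the free algebra, that is,
the span of all products of `i` edges. -/
def gradedPiece (F : Type*) [Field F] (P : Type*) [PartialOrder P] (i : ℕ) : Submodule F (SplittingAlgebra F P) :=
  Submodule.span F (Set.range (edge F)) ^ i

theorem mapEquiv_mem_gradedPiece (σ : P ≃o P) (i : ℕ) (a : SplittingAlgebra F P)
    (ha : a ∈ gradedPiece F P i) : mapEquiv F σ a ∈ gradedPiece F P i := by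
  have h : (gradedPiece F P i).map (mapHom F σ).toLinearMap ≤ gradedPiece F P i := by
    rw [gradedPiece, Submodule.map_pow]
    refine pow_le_pow_left' ?_ i
    rw [Submodule.map_span, Submodule.span_le]
    rintro _ ⟨_, ⟨e, rfl⟩, rfl⟩
    exact Submodule.subset_span ⟨e.map σ, by simp⟩
  exact h ⟨a, ha, rfl⟩

/-! ### The grading -/

/-- The graded pieces of the splitting algebra of a finite poset are finite-dimensional. -/
instance [Finite P] (i : ℕ) : FiniteDimensional F (gradedPiece F P i) := by
  have : Finite (HasseEdge P) :=
    Finite.of_injective (fun e : HasseEdge P => (e.tail, e.head)) fun e f h => by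
      simp only [Prod.mk.injEq] at h
      exact HasseEdge.ext h.1 h.2
  exact Module.Finite.iff_fg.2 ((Submodule.fg_span (Set.finite_range _)).pow i)

instance : SetLike.GradedMonoid (gradedPiece F P) := Submodule.nat_power_gradedMonoid _

theorem edge_mem (e : HasseEdge P) : edge F e ∈ gradedPiece F P 1 := by
  rw [gradedPiece, pow_one]
  exact Submodule.subset_span ⟨e, rfl⟩

/-- Auxiliary map for the decomposition of `A(P)` into its graded pieces. -/
def decomposeFree : FreeAlgebra F (HasseEdge P) →ₐ[F] ⨁ i, gradedPiece F P i :=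
  FreeAlgebra.lift F fun e => DirectSum.of (fun i => gradedPiece F P i) 1 ⟨edge F e, edge_mem F e⟩

theorem coe_decomposeFree (x : FreeAlgebra F (HasseEdge P)) :
    DirectSum.coeAlgHom (gradedPiece F P) (decomposeFree F x)
      = RingQuot.mkAlgHom F (SplittingRel F P) x := by
  have : (DirectSum.coeAlgHom (gradedPiece F P)).comp (decomposeFree F)
      = RingQuot.mkAlgHom F (SplittingRel F P) := by
    apply FreeAlgebra.hom_ext
    funext e
    simp [decomposeFree, edge]
  exact DFunLike.congr_fun this x

theorem coeff_pathPoly_cons (e : HasseEdge P) (l : List (HasseEdge P)) (k : ℕ) :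
    (pathPoly F (e :: l)).coeff k = (Polynomial.X * pathPoly F l).coeff k
      + (-1 : F) • (FreeAlgebra.ι F e * (pathPoly F l).coeff k) := by
  simp [pathPoly, sub_mul, ← sub_eq_add_neg]

theorem coeff_pathPoly_eq_zero (l : List (HasseEdge P)) (k : ℕ) (hk : l.length < k) :
    (pathPoly F l).coeff k = 0 := by
  induction l generalizing k with
  | nil =>
    have : k ≠ 0 := by
      rintro rfl
      simp at hk
    simp [pathPoly, Polynomial.coeff_one, this]
  | cons e l ih =>
    rw [coeff_pathPoly_cons, ih k (by simp at hk; omega)]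
    rcases k with _ | k
    · simp
    · rw [Polynomial.coeff_X_mul, ih k (by simpa using hk)]
      simp

theorem decomposeFree_coeff (l : List (HasseEdge P)) (k m : ℕ) (h : k + m = l.length) :
    decomposeFree F ((pathPoly F l).coeff k)
      ∈ LinearMap.range (DirectSum.lof F ℕ (fun i => gradedPiece F P i) m) := by
  induction l generalizing k m with
  | nil =>
    obtain ⟨rfl, rfl⟩ : k = 0 ∧ m = 0 := by simpa using h
    refine ⟨⟨1, SetLike.GradedOne.one_mem⟩, ?_⟩
    simp only [pathPoly, List.map_nil, List.prod_nil, Polynomial.coeff_one_zero, map_one]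
    rfl
  | cons e l ih =>
    rw [List.length_cons] at h
    rw [coeff_pathPoly_cons, map_add, map_smul]
    refine Submodule.add_mem _ ?_ (Submodule.smul_mem _ _ ?_)
    · rcases k with _ | k
      · simp
      · rw [Polynomial.coeff_X_mul]
        exact ih k m (by omega)
    · rcases m with _ | m
      · rw [coeff_pathPoly_eq_zero F l k (by omega), mul_zero, map_zero]
        exact Submodule.zero_mem _
      · obtain ⟨a, ha⟩ := ih k m (by omega)
        rw [map_mul, ← ha, add_comm m 1]
        exact ⟨_, (DirectSum.of_mul_of (A := fun i => gradedPiece F P i)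
          (⟨edge F e, edge_mem F e⟩ : gradedPiece F P 1) a).symm.trans
            (by simp [decomposeFree, DirectSum.lof_eq_of])⟩

end SplittingAlgebra

theorem HassePath.grade_tail [GradeOrder ℕ P] (π : HassePath P) :
    grade ℕ π.tail = grade ℕ π.head + π.edges.length := by
  obtain ⟨l, hl, hc⟩ := π
  simp only [HassePath.tail, HassePath.head]
  induction l with
  | nil => exact absurd rfl hl
  | cons e l ih =>
    have he : grade ℕ e.head + 1 = grade ℕ e.tail :=
      Order.covBy_iff_add_one_eq.1 (e.covBy.grade ℕ)
    cases l with
    | nil => simp [he]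
    | cons f l =>
      have h := ih (by simp) (List.isChain_cons_cons.1 hc).2
      have h' := (List.isChain_cons_cons.1 hc).1
      simp only [List.head_cons, List.length_cons, List.getLast_cons_cons] at h ⊢
      rw [← he, h', h]
      omega

namespace SplittingAlgebra

/-- The decomposition of `A(P)` into its graded pieces, for a ranked poset `P`. -/
def decompose [GradeOrder ℕ P] : SplittingAlgebra F P →ₐ[F] ⨁ i, gradedPiece F P i :=
  RingQuot.liftAlgHom F ⟨decomposeFree F, by
    rintro _ _ ⟨π₁, π₂, h, k⟩
    have hlen : π₁.edges.length = π₂.edges.length := by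
      have h₁ := π₁.grade_tail
      have h₂ := π₂.grade_tail
      rw [h.1, h.2] at h₁
      omega
    have hmk := RingQuot.mkAlgHom_rel F (SplittingRel.coeff_eq (F := F) _ _ h k)
    rw [← coe_decomposeFree, ← coe_decomposeFree] at hmk
    rcases lt_or_ge π₁.edges.length k with hk | hk
    · rw [coeff_pathPoly_eq_zero F _ k hk, coeff_pathPoly_eq_zero F _ k (hlen ▸ hk)]
    · obtain ⟨m, hm⟩ := Nat.exists_eq_add_of_le hk
      obtain ⟨a, ha⟩ := decomposeFree_coeff F π₁.edges k m hm.symm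
      obtain ⟨b, hb⟩ := decomposeFree_coeff F π₂.edges k m (hm.symm.trans hlen)
      rw [← ha, ← hb] at hmk ⊢
      simp only [DirectSum.lof_eq_of, DirectSum.coeAlgHom_of] at hmk
      rw [Subtype.ext hmk]⟩

theorem decompose_edge [GradeOrder ℕ P] (e : HasseEdge P) :
    decompose F (edge F e)
      = DirectSum.of (fun i => gradedPiece F P i) 1 ⟨edge F e, edge_mem F e⟩ := by
  simp [decompose, edge, decomposeFree]

theorem decompose_of_mem_span [GradeOrder ℕ P] (m : SplittingAlgebra F P)
    (hm : m ∈ Submodule.span F (Set.range (edge F))) :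
    decompose F m
      = DirectSum.of (fun i => gradedPiece F P i) 1 ⟨m, by rwa [gradedPiece, pow_one]⟩ := by
  induction hm using Submodule.span_induction with
  | mem x h =>
    obtain ⟨e, rfl⟩ := h
    exact decompose_edge F e
  | zero => rw [map_zero]; exact (map_zero _).symm
  | add x y hx hy ihx ihy => rw [map_add, ihx, ihy, ← map_add]; rfl
  | smul c x hx ih =>
    rw [map_smul, ih, ← DirectSum.lof_eq_of F, ← map_smul]
    rfl

/-- The splitting algebra of a ranked poset is graded. -/
instance [GradeOrder ℕ P] : GradedAlgebra (gradedPiece F P) :=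
  GradedAlgebra.ofAlgHom (gradedPiece F P) (decompose F)
    (algHom_ext fun e => by simp [decompose_edge])
    (by
      rintro i ⟨x, hx⟩
      dsimp only
      induction hx using Submodule.pow_induction_on_left' with
      | algebraMap r => rw [AlgHom.commutes]; rfl
      | add x y i hx hy ihx ihy => rw [map_add, ihx, ihy, ← map_add]; rfl
      | mem_mul m hm i x hx ih =>
        rw [map_mul, ih, decompose_of_mem_span F m hm, DirectSum.of_mul_of]
        exact DirectSum.of_eq_of_gradedMonoid_eq (Sigma.subtype_ext (add_comm _ _) rfl))

/-- The graded trace generating function `Tr_σ(A(P), z)` of the automorphism of the splitting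
algebra induced by an automorphism `σ` of the finite ranked poset `P`. -/
def trace [Finite P] [GradeOrder ℕ P] (σ : P ≃o P) : F⟦X⟧ :=
  gradedTrace (gradedPiece F P) (mapEquiv F σ) (mapEquiv_mem_gradedPiece F σ)

end SplittingAlgebra

end Action

/-- The permutation of the atoms of `P` given by an automorphism of `P`. -/
def atomPerm {P : Type*} [PartialOrder P] [OrderBot P] (σ : P ≃o P) :
    Equiv.Perm {a : P // IsAtom a} :=
  σ.toEquiv.subtypeEquiv fun a => (σ.isAtom_iff a).symm

open Classical in
/-- The multiset of the lengths of all cycles of a permutation of a finite set, a fixed point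
being a cycle of length `1`. -/
def cycleLengths {α : Type*} [Finite α] (τ : Equiv.Perm α) : Multiset ℕ :=
  letI := Fintype.ofFinite α
  τ.partition.parts

end

/-! For a vertex `v` of rank `r v`, all paths from `v` to `⊥` give one monic polynomial over `A(P)`;
`vertexCoeff v l` is minus its coefficient of `t ^ l`, of degree `r v - l`. If `u < v`, the
polynomial of `v` is a left multiple of that of `u`. With `t` acting as the shift on sequences,
every solution of the recurrence of `u` therefore solves that of `v`. Applied to fundamental
solutions, this gives a straightening rule for each product `(v, r u)(u, j)`, and the words without
such a pair form a basis (`wordBasis`).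

Spanning: the rule holds in `A(P)` (`wordMap_wordOp`), so the span of the words is a left ideal
containing `1`. Independence: the rule defines operators `wordOp` on the free module on admissible
words. The overlaps of the rule are consistent (`isRecurrent_wordOp_of_lt`), so these operators
represent `A(P)`, and a word applied to the empty word returns itself.

An automorphism permutes this basis letter by letter, so the trace counts words in fixed letters
(`coeff_trace`). In the Boolean lattice the fixed vertices are the unions of cycles, that is, the
subsets of the set of cycles, with ranks weighted by cycle lengths (`card_fixed_words`).

Let `W` count all these words and `W_v` those beginning with `v`. Removing the first letter gives
`∑_{w ≤ v} z^(r v - r w) W_w = W ∑_{l < r v} z^(r v - l)`. If `∑_{v ≥ w} g v z^(r v - r w) = 1` for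
all `w`, then `W (1 - z ∑ g v) = 1 - z` (`wordSeries_mul_eq`). For weighted subsets `g S = ∏_{c ∉ S}
(1 - z^(wt c))` works, with sum `∏ (2 - z^(wt c))`. -/

noncomputable section

/-! ### Admissible words -/

section AdmissibleWords

variable {P : Type*} [PartialOrder P]

/-- A word in the letters `(v, l)`, with `l < r v`, is admissible if it has no two consecutive
letters `(v, l)`, `(u, j)` with `u < v` and `r u = l`. -/
def IsAdmissible (r : P → ℕ) : List (P × ℕ) → Prop
  | [] => True
  | a :: L => a.2 < r a.1 ∧ (∀ b ∈ L.head?, ¬ (b.1 < a.1 ∧ r b.1 = a.2)) ∧ IsAdmissible r L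

/-- The type of admissible words. -/
abbrev AdmissibleWord (r : P → ℕ) : Type _ := {L : List (P × ℕ) // IsAdmissible r L}

variable (F : Type*) [Field F] (r : P → ℕ)

/-- The vector space on the admissible words. -/
abbrev WordModule : Type _ := AdmissibleWord r →₀ F

open Classical in
/-- The basis vector of an admissible word, and `0` for the other words. -/
def wordVec (L : List (P × ℕ)) : WordModule F r :=
  if h : IsAdmissible r L then Finsupp.single ⟨L, h⟩ 1 else 0

theorem wordVec_of_adm {L : List (P × ℕ)} (h : IsAdmissible r L) :
    wordVec F r L = Finsupp.single ⟨L, h⟩ 1 := dif_pos h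

variable {F r} in
/-- Extension of a function on words to a linear map. -/
def liftWord {N : Type*} [AddCommGroup N] [Module F N] (f : List (P × ℕ) → N) :
    WordModule F r →ₗ[F] N :=
  Finsupp.linearCombination F fun x : AdmissibleWord r => f x.1

variable {F r} in
theorem liftWord_wordVec {N : Type*} [AddCommGroup N] [Module F N] (f : List (P × ℕ) → N)
    {L : List (P × ℕ)} (h : IsAdmissible r L) : liftWord f (wordVec F r L) = f L := by
  simp [liftWord, wordVec_of_adm F r h]

variable {F r} in
theorem wordModule_hom_ext {N : Type*} [AddCommGroup N] [Module F N]
    {f g : WordModule F r →ₗ[F] N}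
    (h : ∀ L, IsAdmissible r L → f (wordVec F r L) = g (wordVec F r L)) : f = g := by
  refine Finsupp.lhom_ext' fun x => LinearMap.ext_ring ?_
  simpa [wordVec_of_adm F r x.2] using h x.1 x.2

/-- Putting a letter in front of a word. -/
def consWord (v : P) (l : ℕ) : Module.End F (WordModule F r) :=
  liftWord fun L => wordVec F r ((v, l) :: L)

/-- The subspace spanned by the words whose first letter has rank at most `k`. -/
def lowWords (k : ℕ) : Submodule F (WordModule F r) :=
  Submodule.span F (wordVec F r '' {L | IsAdmissible r L ∧ ∀ a ∈ L.head?, r a.1 ≤ k})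

theorem lowWords_mono {k k' : ℕ} (h : k ≤ k') : lowWords F r k ≤ lowWords F r k' :=
  Submodule.span_mono (Set.image_mono fun _ hL => ⟨hL.1, fun a ha => (hL.2 a ha).trans h⟩)

theorem wordVec_mem_lowWords {k : ℕ} {L : List (P × ℕ)} (h : ∀ a ∈ L.head?, r a.1 ≤ k) :
    wordVec F r L ∈ lowWords F r k := by
  by_cases hL : IsAdmissible r L
  · exact Submodule.subset_span ⟨L, ⟨hL, h⟩, rfl⟩
  · rw [wordVec, dif_neg hL]
    exact zero_mem _

theorem consWord_mem_lowWords (v : P) (l : ℕ) (m : WordModule F r) :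
    consWord F r v l m ∈ lowWords F r (r v) := by
  induction m using Finsupp.induction_linear with
  | zero => simp
  | add x y hx hy => rw [map_add]; exact add_mem hx hy
  | single x c =>
    simp only [consWord, liftWord, Finsupp.linearCombination_single]
    exact Submodule.smul_mem _ _ (wordVec_mem_lowWords F r (by simp))

end AdmissibleWords

/-! ### Linear recurrences -/

section Recurrence

variable {R N : Type*} [Ring R] [AddCommGroup N] [Module R N]

/-- The sequences satisfying the linear recurrence of order `k` with coefficients `f`. -/
def IsRecurrent (k : ℕ) (f : ℕ → R) (m : ℕ → N) : Prop :=
  ∀ p, m (p + k) = ∑ q ∈ Finset.range k, f q • m (p + q)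

/-- The fundamental solution of a linear recurrence, with initial values `0`, except for the value
`1` at `j`. -/
def fundSol (k : ℕ) (f : ℕ → R) (j p : ℕ) : R :=
  if p < k then (if p = j then 1 else 0)
  else ∑ q : Fin k, f q * fundSol k f j (p - k + q)
termination_by p
decreasing_by omega

theorem fundSol_of_lt {k : ℕ} (f : ℕ → R) (j : ℕ) {p : ℕ} (h : p < k) :
    fundSol k f j p = if p = j then 1 else 0 := by
  rw [fundSol, if_pos h]

theorem fundSol_add (k : ℕ) (f : ℕ → R) (j p : ℕ) :
    fundSol k f j (p + k) = ∑ q ∈ Finset.range k, f q * fundSol k f j (p + q) := by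
  rw [fundSol, if_neg (by omega), Finset.sum_range]
  simp

/-- This makes the letter `(u, j)` a value, at index `r u`, of the fundamental solution attached to
`u` and `j`. -/
theorem fundSol_self {k : ℕ} (f : ℕ → R) {j : ℕ} (h : j < k) : fundSol k f j k = f j := by
  have := fundSol_add k f j 0
  simp only [zero_add] at this
  rw [this, Finset.sum_eq_single j]
  · simp [fundSol_of_lt f j h]
  · intro q hq hqj
    simp [fundSol_of_lt f j (Finset.mem_range.1 hq), hqj]
  · simp [h]

theorem isRecurrent_fundSol (k : ℕ) (f : ℕ → R) (j : ℕ) (x : N) :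
    IsRecurrent k f fun p => fundSol k f j p • x := by
  intro p
  simp only [fundSol_add, Finset.sum_smul, mul_smul]

/-- A solution is determined by its first `k` terms. The recurrence multiplies on the left, so the
fundamental values stand to the left of the initial terms. -/
theorem IsRecurrent.eq_sum {k : ℕ} {f : ℕ → R} {m : ℕ → N} (h : IsRecurrent k f m) (p : ℕ) :
    m p = ∑ j ∈ Finset.range k, fundSol k f j p • m j := by
  induction p using Nat.strong_induction_on with
  | _ p ih =>
    rcases lt_or_ge p k with hp | hp
    · rw [Finset.sum_eq_single p]
      · simp [fundSol_of_lt f p hp]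
      · intro j _ hj
        simp [fundSol_of_lt f j hp, hj.symm]
      · simp [hp]
    · obtain ⟨p, rfl⟩ := Nat.exists_eq_add_of_le' hp
      rw [h p]
      simp only [fundSol_add, Finset.sum_smul, mul_smul]
      rw [Finset.sum_comm]
      refine Finset.sum_congr rfl fun q hq => ?_
      rw [ih (p + q) (by have := Finset.mem_range.1 hq; omega), Finset.smul_sum]

theorem IsRecurrent.shift {k : ℕ} {f : ℕ → R} {m : ℕ → N} (h : IsRecurrent k f m) (a : ℕ) :
    IsRecurrent k f fun p => m (p + a) := by
  intro p
  have := h (p + a)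
  simp only [add_right_comm] at this ⊢
  exact this

end Recurrence

/-! ### The operators on the word module -/

section WordOperators

variable {P : Type*} [PartialOrder P] (F : Type*) [Field F] (r : P → ℕ)

open Classical in
/-- The operator attached to the letter `(v, l)`, on words, given the operators attached to the
elements below `v`. -/
def wordOpAux (v : P) (below : ∀ u, u < v → ℕ → Module.End F (WordModule F r)) (l : ℕ) :
    List (P × ℕ) → WordModule F r
  | [] => wordVec F r [(v, l)]
  | (u, j) :: L =>
    if h : u < v ∧ r u = l then
      -- Let `s` be the fundamental solution of `u` at `j`, applied to `L`. The recurrence of `v` at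
      -- index `0` should read `s (r v) = (v, j) L + (v, r u)(u, j) L + ∑ (v, p) s p`, the sum over
      -- `r u < p < r v`; it is solved for the middle term. Each `s p` in the sum begins with
      -- letters of rank at most `r u < p`, so plain concatenation suffices there.
      fundSol (r u) (below u h.1) j (r v) (wordVec F r L) - wordOpAux v below j L
        - ∑ p ∈ Finset.Ioo l (r v),
          consWord F r v p (fundSol (r u) (below u h.1) j p (wordVec F r L))
    else wordVec F r ((v, l) :: (u, j) :: L)

variable [WellFoundedLT P]

/-- The operator attached to the letter `(v, l)`. -/
def wordOp (v : P) : ℕ → Module.End F (WordModule F r) :=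
  (wellFounded_lt (α := P)).fix (fun v below l => liftWord (wordOpAux F r v below l)) v

theorem wordOp_eq (v : P) (l : ℕ) :
    wordOp F r v l = liftWord (wordOpAux F r v (fun u _ => wordOp F r u) l) := by
  rw [wordOp, WellFounded.fix_eq]
  rfl

variable {F r}

theorem wordOp_of_adm (v : P) (l : ℕ) {L : List (P × ℕ)} (hL : IsAdmissible r L)
    (h : ∀ b ∈ L.head?, ¬ (b.1 < v ∧ r b.1 = l)) :
    wordOp F r v l (wordVec F r L) = wordVec F r ((v, l) :: L) := by
  rw [wordOp_eq, liftWord_wordVec _ hL]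
  rcases L with _ | ⟨⟨u, j⟩, L⟩
  · rfl
  · rw [wordOpAux, dif_neg (h (u, j) (by simp))]

theorem wordOp_of_lt {u v : P} (huv : u < v) {j : ℕ} {L : List (P × ℕ)}
    (hL : IsAdmissible r ((u, j) :: L)) :
    wordOp F r v (r u) (wordVec F r ((u, j) :: L)) =
      fundSol (r u) (wordOp F r u) j (r v) (wordVec F r L) - wordOp F r v j (wordVec F r L)
        - ∑ p ∈ Finset.Ioo (r u) (r v),
          consWord F r v p (fundSol (r u) (wordOp F r u) j p (wordVec F r L)) := by
  conv_lhs => rw [wordOp_eq, liftWord_wordVec _ hL, wordOpAux, dif_pos ⟨huv, rfl⟩]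
  conv_rhs => rw [wordOp_eq, liftWord_wordVec _ hL.2.2]

/-- From index `r u` on, the recurrence makes each value a sum of images of the operators of `u`. -/
theorem fundSol_mem_lowWords {u : P} (h : ∀ l m, wordOp F r u l m ∈ lowWords F r (r u))
    (j : ℕ) {p : ℕ} (hp : r u ≤ p) (m : WordModule F r) :
    fundSol (r u) (wordOp F r u) j p m ∈ lowWords F r (r u) := by
  obtain ⟨p, rfl⟩ := Nat.exists_eq_add_of_le' hp
  rw [fundSol_add, LinearMap.sum_apply]
  exact Submodule.sum_mem _ fun q _ => h _ _

/-- Two nested inductions: on the vertex for the fundamental values of smaller `u`, on the word for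
the term acting on the shorter word. -/
theorem wordOp_mem_lowWords (hr : StrictMono r) (v : P) (l : ℕ) (m : WordModule F r) :
    wordOp F r v l m ∈ lowWords F r (r v) := by
  induction v using WellFoundedLT.induction generalizing l m with
  | _ v ih =>
  have key : ∀ (L : List (P × ℕ)) (l : ℕ), IsAdmissible r L →
      wordOp F r v l (wordVec F r L) ∈ lowWords F r (r v) := by
    intro L
    induction L with
    | nil =>
      intro l hL
      rw [wordOp_of_adm v l hL (by simp)]
      exact wordVec_mem_lowWords F r (by simp)
    | cons a L ihL =>
      obtain ⟨u, j⟩ := a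
      intro l hL
      by_cases h : u < v ∧ r u = l
      · obtain ⟨huv, rfl⟩ := h
        rw [wordOp_of_lt huv hL]
        refine sub_mem (sub_mem ?_ (ihL _ hL.2.2))
          (Submodule.sum_mem _ fun p _ => consWord_mem_lowWords F r _ _ _)
        exact lowWords_mono F r (hr huv).le
          (fundSol_mem_lowWords (fun l m => ih u huv l m) j (hr huv).le _)
      · rw [wordOp_of_adm v l hL (by simpa using h)]
        exact wordVec_mem_lowWords F r (by simp)
  induction m using Finsupp.induction_linear with
  | zero => simp
  | add x y hx hy => rw [map_add]; exact add_mem hx hy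
  | single x c =>
    have := key x.1 l x.2
    rw [wordVec_of_adm F r x.2] at this
    rw [← mul_one c, ← smul_eq_mul, ← Finsupp.smul_single, map_smul]
    exact Submodule.smul_mem _ _ this

/-- A forbidden pair would need a second letter of rank exactly `l`, whereas first letters here have
rank at most `k < l`. -/
theorem wordOp_eq_consWord {k l : ℕ} (hkl : k < l) (v : P) {m : WordModule F r}
    (hm : m ∈ lowWords F r k) : wordOp F r v l m = consWord F r v l m := by
  refine LinearMap.eqOn_span ?_ hm
  rintro _ ⟨L, ⟨hL, h⟩, rfl⟩
  rw [consWord, liftWord_wordVec _ hL]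
  refine wordOp_of_adm v l hL fun b hb hb' => ?_
  have := h b hb
  omega

/-- The definition of `wordOp` on `(w, j) :: L`, read backwards: indices below `r w` contribute only
`q = j`, the index `r w` gives the word itself, and later indices are concatenations. -/
theorem wordOp_recurrence_of_adm (hr : StrictMono r) {w v : P} (hwv : w < v) {j : ℕ}
    {L : List (P × ℕ)} (hL : IsAdmissible r ((w, j) :: L)) :
    fundSol (r w) (wordOp F r w) j (r v) (wordVec F r L) =
      ∑ q ∈ Finset.range (r v),
        wordOp F r v q (fundSol (r w) (wordOp F r w) j q (wordVec F r L)) := by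
  have hj : j < r w := hL.1
  have hlt := hr hwv
  have hself : fundSol (r w) (wordOp F r w) j (r w) (wordVec F r L)
      = wordVec F r ((w, j) :: L) := by
    rw [fundSol_self _ hj, wordOp_of_adm w j hL.2.2 hL.2.1]
  have hlow : ∑ q ∈ Finset.range (r w),
      wordOp F r v q (fundSol (r w) (wordOp F r w) j q (wordVec F r L))
        = wordOp F r v j (wordVec F r L) := by
    rw [Finset.sum_eq_single j]
    · simp [fundSol_of_lt _ j hj]
    · intro q hq hqj
      simp [fundSol_of_lt _ j (Finset.mem_range.1 hq), hqj]
    · simp [hj]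
  have hhigh : ∑ q ∈ Finset.Ioo (r w) (r v),
      wordOp F r v q (fundSol (r w) (wordOp F r w) j q (wordVec F r L))
        = ∑ q ∈ Finset.Ioo (r w) (r v),
          consWord F r v q (fundSol (r w) (wordOp F r w) j q (wordVec F r L)) := by
    refine Finset.sum_congr rfl fun q hq => ?_
    rw [Finset.mem_Ioo] at hq
    exact wordOp_eq_consWord hq.1 v
      (fundSol_mem_lowWords (wordOp_mem_lowWords hr w) j hq.1.le _)
  rw [← Finset.sum_range_add_sum_Ico _ hlt.le, ← Finset.Ioo_insert_left hlt,
    Finset.sum_insert (by simp), hlow, hhigh, hself, wordOp_of_lt hwv hL]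
  abel

theorem wordOp_recurrence_of_lowWords (hr : StrictMono r) {w v : P} (hwv : w < v) {k j : ℕ}
    (hkj : k < j) (hj : j < r w) {m : WordModule F r} (hm : m ∈ lowWords F r k) :
    fundSol (r w) (wordOp F r w) j (r v) m =
      ∑ q ∈ Finset.range (r v), wordOp F r v q (fundSol (r w) (wordOp F r w) j q m) := by
  have := LinearMap.eqOn_span
    (s := wordVec F r '' {L | IsAdmissible r L ∧ ∀ a ∈ L.head?, r a.1 ≤ k})
    (f := fundSol (r w) (wordOp F r w) j (r v))
    (g := ∑ q ∈ Finset.range (r v), wordOp F r v q * fundSol (r w) (wordOp F r w) j q) ?_ hm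
  · simpa [LinearMap.sum_apply] using this
  · rintro _ ⟨L, ⟨hL, h⟩, rfl⟩
    simp only [LinearMap.sum_apply, Module.End.mul_apply]
    refine wordOp_recurrence_of_adm hr hwv ⟨hj, fun b hb hb' => ?_, hL⟩
    have := h b hb
    omega

/-- A solution of the recurrence attached to `w` is a solution of the recurrence attached to any
larger `v`. -/
theorem isRecurrent_wordOp_of_lt (hr : StrictMono r) {w v : P} (hwv : w < v)
    {m : ℕ → WordModule F r} (hm : IsRecurrent (r w) (wordOp F r w) m) :
    IsRecurrent (r v) (wordOp F r v) m := by
  induction v using WellFoundedLT.induction generalizing w m with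
  | _ v ih =>
  have key : ∀ (L : List (P × ℕ)), IsAdmissible r L → ∀ j < r w,
      fundSol (r w) (wordOp F r w) j (r v) (wordVec F r L) = ∑ q ∈ Finset.range (r v),
        wordOp F r v q (fundSol (r w) (wordOp F r w) j q (wordVec F r L)) := by
    intro L
    induction L with
    | nil => exact fun hL j hj => wordOp_recurrence_of_adm hr hwv ⟨hj, by simp, hL⟩
    | cons a L ihL =>
      obtain ⟨u, i⟩ := a
      intro hL j hj
      by_cases h : u < w ∧ r u = j
      swap
      · exact wordOp_recurrence_of_adm hr hwv ⟨hj, by simpa using h, hL⟩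
      -- The overlap `u < w < v`, where `(w, r u)` meets `(u, i)`: the word is not admissible and
      -- consistency must be proved. The fundamental solution `s` of `u` solves the recurrence of
      -- `w` by the outer induction.
      obtain ⟨huw, rfl⟩ := h
      have hi : i < r u := hL.1
      set s : ℕ → WordModule F r := fun p => fundSol (r u) (wordOp F r u) i p (wordVec F r L)
        with hs
      have hsrec : IsRecurrent (r w) (wordOp F r w) s :=
        ih w hwv huw (isRecurrent_fundSol (r u) (wordOp F r u) i (wordVec F r L))
      have hself : s (r u) = wordVec F r ((u, i) :: L) := by
        simp only [hs]
        rw [fundSol_self _ hi, wordOp_of_adm u i hL.2.2 hL.2.1]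
      -- Expand `s` by its first `r w` terms. The recurrence of `v` is known for `s`, for the
      -- `i`-term (shorter word) and for the terms between `r u` and `r w` (low words); subtraction
      -- leaves the wanted `r u`-term.
      have hsum : ∀ p, s p = fundSol (r w) (wordOp F r w) i p (wordVec F r L)
          + (fundSol (r w) (wordOp F r w) (r u) p (wordVec F r ((u, i) :: L))
          + ∑ q ∈ Finset.Ioo (r u) (r w), fundSol (r w) (wordOp F r w) q p (s q)) := by
        intro p
        rw [hsrec.eq_sum p, ← Finset.sum_range_add_sum_Ico _ hj.le, ← Finset.Ioo_insert_left hj,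
          Finset.sum_insert (by simp), hself]
        congr 1
        rw [Finset.sum_eq_single i]
        · simp [hs, fundSol_of_lt _ i hi]
        · intro q hq hqj
          simp [hs, fundSol_of_lt _ i (Finset.mem_range.1 hq), hqj]
        · simp [hi]
      have h₁ : s (r v) = ∑ q ∈ Finset.range (r v), wordOp F r v q (s q) :=
        wordOp_recurrence_of_adm hr (huw.trans hwv) hL
      have h₂ := ihL hL.2.2 i (hi.trans hj)
      have h₃ : ∑ q ∈ Finset.Ioo (r u) (r w), fundSol (r w) (wordOp F r w) q (r v) (s q)
          = ∑ q ∈ Finset.Ioo (r u) (r w), ∑ p ∈ Finset.range (r v),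
            wordOp F r v p (fundSol (r w) (wordOp F r w) q p (s q)) := by
        refine Finset.sum_congr rfl fun q hq => ?_
        rw [Finset.mem_Ioo] at hq
        exact wordOp_recurrence_of_lowWords hr hwv hq.1 hq.2
          (fundSol_mem_lowWords (wordOp_mem_lowWords hr u) i hq.1.le _)
      rw [Finset.sum_congr rfl fun q _ => by rw [hsum q]] at h₁
      simp only [map_add, map_sum, Finset.sum_add_distrib] at h₁
      rw [hsum, h₂, h₃, Finset.sum_comm] at h₁
      exact add_right_cancel (add_left_cancel h₁)
  have key' : ∀ j < r w, fundSol (r w) (wordOp F r w) j (r v) = ∑ q ∈ Finset.range (r v),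
      wordOp F r v q * fundSol (r w) (wordOp F r w) j q := fun j hj =>
    wordModule_hom_ext fun L hL => by
      simpa only [LinearMap.sum_apply, Module.End.mul_apply] using key L hL j hj
  intro p
  -- By shifting, only index `0` matters; there the solution is a combination of the fundamental
  -- ones treated in `key'`.
  have hsh := hm.shift p
  have e := hsh.eq_sum (r v)
  rw [add_comm (r v) p] at e
  rw [e, Finset.sum_congr rfl fun j hj => by rw [key' j (Finset.mem_range.1 hj)]]
  simp only [Finset.sum_smul, mul_smul]
  rw [Finset.sum_comm]
  refine Finset.sum_congr rfl fun q _ => ?_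
  rw [← Finset.smul_sum, ← hsh.eq_sum q, add_comm q p]

end WordOperators

/-! ### Characteristic polynomials of recurrences -/

section CharPoly

open Polynomial

variable {R : Type*} [Ring R]

/-- The characteristic polynomial `t ^ k - ∑ q < k, f q * t ^ q` of a linear recurrence. -/
def recPoly (k : ℕ) (f : ℕ → R) : R[X] :=
  X ^ k - ∑ q ∈ Finset.range k, C (f q) * X ^ q

theorem coeff_recPoly (k : ℕ) (f : ℕ → R) (l : ℕ) :
    (recPoly k f).coeff l = (if l = k then 1 else 0) - if l < k then f l else 0 := by
  simp only [recPoly, coeff_sub, coeff_X_pow, finsetSum_coeff, coeff_C_mul]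
  congr 1
  split_ifs with h
  · rw [Finset.sum_eq_single l]
    · simp
    · intro q _ hq
      simp [hq.symm]
    · simp [h]
  · refine Finset.sum_eq_zero fun q hq => ?_
    rw [if_neg, mul_zero]
    rintro rfl
    exact h (Finset.mem_range.1 hq)

theorem Polynomial.Monic.eq_recPoly {p : R[X]} (hp : p.Monic) :
    p = recPoly p.natDegree fun l => -p.coeff l := by
  conv_lhs => rw [hp.as_sum]
  simp [recPoly, sub_eq_add_neg]

theorem natDegree_recPoly_le (k : ℕ) (f : ℕ → R) : (recPoly k f).natDegree ≤ k := by
  rw [natDegree_le_iff_coeff_eq_zero]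
  intro l hl
  rw [coeff_recPoly, if_neg (by omega), if_neg (by omega), sub_zero]

theorem monic_recPoly (k : ℕ) (f : ℕ → R) : (recPoly k f).Monic :=
  monic_of_natDegree_le_of_coeff_eq_one k (natDegree_recPoly_le k f) (by simp [coeff_recPoly])

/-- The linear polynomial `t - e`. -/
def linPoly (e : R) : R[X] := X - C e

theorem monic_linPoly (e : R) : (linPoly e).Monic := monic_X_sub_C e

/-- The shift of a sequence of coefficients, with first term `0`. -/
def shiftCoeff (f : ℕ → R) : ℕ → R
  | 0 => 0
  | l + 1 => f l

/-- The coefficient of `t ^ k` determines `e`; the lower coefficients are the only genuine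
conditions. -/
theorem linPoly_mul_recPoly_eq_iff (k : ℕ) (f g : ℕ → R) (e : R) :
    recPoly (k + 1) g = linPoly e * recPoly k f ↔
      (∀ l < k, g l + e * f l = shiftCoeff f l) ∧ e = g k - shiftCoeff f k := by
  have hc : ∀ l, (linPoly e * recPoly k f).coeff l =
      (if l = k + 1 then 1 else 0) - (if l < k + 1 then shiftCoeff f l else 0)
        - e * ((if l = k then 1 else 0) - if l < k then f l else 0) := by
    intro l
    rw [linPoly, sub_mul, coeff_sub, coeff_C_mul, coeff_recPoly]
    congr 1
    rcases l with _ | l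
    · simp [shiftCoeff]
    · simp [coeff_X_mul, coeff_recPoly, shiftCoeff]
  rw [Polynomial.ext_iff]
  simp only [hc, coeff_recPoly]
  constructor
  · intro h
    refine ⟨fun l hl => ?_, ?_⟩
    · have := h l
      rw [if_neg (by omega), if_pos (by omega), if_pos (by omega), if_neg (by omega),
        if_pos hl] at this
      have h' : g l = shiftCoeff f l - e * f l := by
        have := congrArg Neg.neg this
        simpa [sub_eq_add_neg, add_comm] using this
      rw [h', sub_add_cancel]
    · have := h k
      rw [if_neg (by omega), if_pos (by omega), if_pos (by omega), if_pos rfl,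
        if_neg (by omega)] at this
      have h' : g k = shiftCoeff f k + e := by
        have := congrArg Neg.neg this
        simpa [sub_eq_add_neg, add_comm] using this
      rw [h', add_sub_cancel_left]
  · rintro ⟨h₁, h₂⟩ l
    rcases lt_trichotomy l k with hl | rfl | hl
    · rw [if_neg (by omega), if_pos (by omega), if_pos (by omega), if_neg (by omega),
        if_pos hl, ← h₁ l hl]
      simp [sub_eq_add_neg]
    · rw [if_neg (by omega), if_pos (by omega), if_pos (by omega), if_pos rfl,
        if_neg (by omega), h₂]
      simp [sub_eq_add_neg]
    · have h3 : ¬ l < k + 1 := by omega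
      have h4 : ¬ l = k := by omega
      have h5 : ¬ l < k := by omega
      simp [h3, h4, h5]

/-- A recurrence says that `recPoly`, with `t` acting as the shift, kills the sequence; a left
multiple kills it as well. -/
theorem IsRecurrent.of_recPoly_eq {N : Type*} [AddCommGroup N] [Module R N] {k : ℕ} {f g : ℕ → R}
    {e : R} (h : recPoly (k + 1) g = linPoly e * recPoly k f) {m : ℕ → N}
    (hm : IsRecurrent k f m) : IsRecurrent (k + 1) g m := by
  obtain ⟨h₁, h₂⟩ := (linPoly_mul_recPoly_eq_iff k f g e).1 h
  intro p
  have hs : ∑ l ∈ Finset.range (k + 1), shiftCoeff f l • m (p + l) = m (p + (k + 1)) := by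
    rw [Finset.sum_range_succ', shiftCoeff, zero_smul, add_zero, add_comm k 1, ← add_assoc,
      hm (p + 1)]
    refine Finset.sum_congr rfl fun q _ => ?_
    rw [shiftCoeff, add_assoc, add_comm 1 q]
  have he : e • m (p + k) = ∑ l ∈ Finset.range k, (e * f l) • m (p + l) := by
    rw [hm p, Finset.smul_sum]
    simp only [mul_smul]
  have hg : g k = shiftCoeff f k + e := by rw [h₂]; abel
  rw [← hs, Finset.sum_range_succ, Finset.sum_range_succ, hg, add_smul, he,
    Finset.sum_congr rfl fun l hl => by rw [← h₁ l (Finset.mem_range.1 hl)]]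
  simp only [add_smul, Finset.sum_add_distrib]
  abel

end CharPoly

/-! ### Paths with given ends -/

section Paths

open Polynomial

variable {P : Type*} [PartialOrder P]

/-- The list of edges is a (possibly empty) path from `v` to `u`. -/
def IsPathBetween (v u : P) : List (HasseEdge P) → Prop
  | [] => v = u
  | e :: l => e.tail = v ∧ IsPathBetween e.head u l

theorem exists_isPathBetween [Finite P] {u v : P} (h : u ≤ v) : ∃ l, IsPathBetween v u l := by
  induction v using WellFoundedLT.induction with
  | _ v ih =>
  rcases h.eq_or_lt with rfl | h
  · exact ⟨[], rfl⟩
  · obtain ⟨w, huw, hwv⟩ := exists_le_covBy_of_lt h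
    obtain ⟨l, hl⟩ := ih w hwv.lt huw
    exact ⟨⟨v, w, hwv⟩ :: l, rfl, hl⟩

theorem IsPathBetween.isChain {v u : P} {l : List (HasseEdge P)} (h : IsPathBetween v u l) :
    l.IsChain (fun e f => e.head = f.tail) := by
  induction l generalizing v with
  | nil => exact List.isChain_nil
  | cons e l ih =>
    cases l with
    | nil => exact List.isChain_singleton _
    | cons f l => exact List.isChain_cons_cons.2 ⟨h.2.1.symm, ih h.2⟩

theorem IsPathBetween.head_eq {v u : P} {l : List (HasseEdge P)} (h : IsPathBetween v u l)
    (hl : l ≠ []) : (l.head hl).tail = v := by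
  cases l with
  | nil => exact absurd rfl hl
  | cons e l => exact h.1

theorem IsPathBetween.getLast_eq {v u : P} {l : List (HasseEdge P)} (h : IsPathBetween v u l)
    (hl : l ≠ []) : (l.getLast hl).head = u := by
  induction l generalizing v with
  | nil => exact absurd rfl hl
  | cons e l ih =>
    cases l with
    | nil => exact h.2
    | cons f l => simpa using ih h.2 (by simp)

theorem isPathBetween_of_isChain {l : List (HasseEdge P)}
    (h : l.IsChain (fun e f => e.head = f.tail)) (hl : l ≠ []) :
    IsPathBetween (l.head hl).tail (l.getLast hl).head l := by
  induction l with
  | nil => exact absurd rfl hl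
  | cons e l ih =>
    cases l with
    | nil => exact ⟨rfl, rfl⟩
    | cons f l =>
      obtain ⟨h₁, h₂⟩ := List.isChain_cons_cons.1 h
      refine ⟨rfl, ?_⟩
      rw [h₁]
      exact ih h₂ (by simp)

theorem IsPathBetween.map (σ : P ≃o P) {v u : P} {l : List (HasseEdge P)}
    (h : IsPathBetween v u l) : IsPathBetween (σ v) (σ u) (l.map (HasseEdge.map σ)) := by
  induction l generalizing v with
  | nil => exact congrArg σ h
  | cons e l ih => exact ⟨congrArg σ h.1, ih h.2⟩

theorem grade_tail_eq [GradeOrder ℕ P] (e : HasseEdge P) :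
    grade ℕ e.tail = grade ℕ e.head + 1 :=
  (Order.covBy_iff_add_one_eq.1 (e.covBy.grade ℕ)).symm

theorem IsPathBetween.grade_eq [GradeOrder ℕ P] {v u : P} {l : List (HasseEdge P)}
    (h : IsPathBetween v u l) : grade ℕ v = grade ℕ u + l.length := by
  induction l generalizing v with
  | nil => cases h; simp
  | cons e l ih =>
    rw [← h.1, grade_tail_eq, ih h.2, List.length_cons, add_assoc]

end Paths

/-! ### The polynomials of the vertices -/

namespace SplittingAlgebra

open Polynomial

variable (F : Type*) [Field F] {P : Type*} [PartialOrder P]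

/-- The image in the splitting algebra of the polynomial attached to a list of edges. -/
def edgePoly (l : List (HasseEdge P)) : (SplittingAlgebra F P)[X] :=
  (l.map fun e => linPoly (edge F e)).prod

theorem map_pathPoly {B : Type*} [Ring B] [Algebra F B] (f : FreeAlgebra F (HasseEdge P) →ₐ[F] B)
    (l : List (HasseEdge P)) :
    (pathPoly F l).map (f : FreeAlgebra F (HasseEdge P) →+* B)
      = (l.map fun e => linPoly (f (FreeAlgebra.ι F e))).prod := by
  induction l with
  | nil => simp [pathPoly]
  | cons e l ih =>
    rw [pathPoly, List.map_cons, List.prod_cons, Polynomial.map_mul, ← pathPoly, ih]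
    simp [linPoly]

theorem edgePoly_eq_map (l : List (HasseEdge P)) :
    edgePoly F l = (pathPoly F l).map
      (RingQuot.mkAlgHom F (SplittingRel F P) : FreeAlgebra F (HasseEdge P) →+* _) :=
  (map_pathPoly F _ l).symm

theorem edgePoly_cons (e : HasseEdge P) (l : List (HasseEdge P)) :
    edgePoly F (e :: l) = linPoly (edge F e) * edgePoly F l := by
  simp [edgePoly]

theorem edgePoly_monic (l : List (HasseEdge P)) : (edgePoly F l).Monic := by
  induction l with
  | nil => simp [edgePoly]
  | cons e l ih => rw [edgePoly_cons]; exact (monic_linPoly _).mul ih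

theorem edgePoly_natDegree [Nontrivial (SplittingAlgebra F P)] (l : List (HasseEdge P)) :
    (edgePoly F l).natDegree = l.length := by
  induction l with
  | nil => simp [edgePoly]
  | cons e l ih =>
    rw [edgePoly_cons, (monic_linPoly _).natDegree_mul (edgePoly_monic F l), ih,
      linPoly, natDegree_X_sub_C, List.length_cons, add_comm]

theorem edgePoly_eq [GradeOrder ℕ P] {v u : P} {l l' : List (HasseEdge P)}
    (h : IsPathBetween v u l) (h' : IsPathBetween v u l') : edgePoly F l = edgePoly F l' := by
  have hlen : l.length = l'.length := by
    have := h.grade_eq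
    have := h'.grade_eq
    omega
  -- The defining relations concern nonempty paths only; if one path is empty, so is the other,
  -- since their lengths agree.
  by_cases hl : l = []
  · subst hl
    rw [List.length_nil] at hlen
    rw [List.length_eq_zero_iff.1 hlen.symm]
  · have hl' : l' ≠ [] := by
      rintro rfl
      exact hl (List.length_eq_zero_iff.1 hlen)
    rw [edgePoly_eq_map, edgePoly_eq_map]
    ext k
    rw [coeff_map, coeff_map]
    refine RingQuot.mkAlgHom_rel F (SplittingRel.coeff_eq ⟨l, hl, h.isChain⟩ ⟨l', hl', h'.isChain⟩
      ⟨?_, ?_⟩ k)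
    · exact (h.head_eq hl).trans (h'.head_eq hl').symm
    · exact (h.getLast_eq hl).trans (h'.getLast_eq hl').symm

theorem map_edgePoly (σ : P ≃o P) (l : List (HasseEdge P)) :
    (edgePoly F l).map (mapHom F σ : SplittingAlgebra F P →+* SplittingAlgebra F P)
      = edgePoly F (l.map (HasseEdge.map σ)) := by
  induction l with
  | nil => simp [edgePoly]
  | cons e l ih => simp [edgePoly_cons, ih, linPoly]

/-- Sending all edges to `0` respects the relations: the polynomial of a path becomes `X ^ length`,
and the length depends only on the ends. -/
theorem nontrivial_of_gradeOrder [GradeOrder ℕ P] : Nontrivial (SplittingAlgebra F P) := by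
  refine RingHom.domain_nontrivial (RingQuot.liftAlgHom F ⟨FreeAlgebra.lift F 0, ?_⟩ :
    SplittingAlgebra F P →ₐ[F] F).toRingHom
  rintro _ _ ⟨π₁, π₂, h, k⟩
  have hlen : π₁.edges.length = π₂.edges.length := by
    have h₁ := π₁.grade_tail
    have h₂ := π₂.grade_tail
    rw [h.1, h.2] at h₁
    omega
  have key : ∀ l : List (HasseEdge P), (FreeAlgebra.lift F (0 : HasseEdge P → F))
      ((pathPoly F l).coeff k) = (X ^ l.length : F[X]).coeff k := by
    intro l
    have := map_pathPoly F (FreeAlgebra.lift F (0 : HasseEdge P → F)) l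
    simp only [linPoly, FreeAlgebra.lift_ι_apply, Pi.zero_apply, map_zero, sub_zero, List.map_const',
      List.prod_replicate] at this
    rw [← this, coeff_map]
    rfl
  rw [key, key, hlen]

section Vertex

variable [Finite P] [OrderBot P]

/-- The polynomial attached to the paths from the vertex `v` to the smallest element. -/
def vertexPoly (v : P) : (SplittingAlgebra F P)[X] :=
  edgePoly F (exists_isPathBetween (bot_le : ⊥ ≤ v)).choose

/-- The coefficients of the recurrence attached to `v`. -/
def vertexCoeff (v : P) (l : ℕ) : SplittingAlgebra F P := -(vertexPoly F v).coeff l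

variable [GradeMinOrder ℕ P]

theorem vertexPoly_eq {v : P} {l : List (HasseEdge P)} (h : IsPathBetween v ⊥ l) :
    vertexPoly F v = edgePoly F l :=
  edgePoly_eq F (exists_isPathBetween (bot_le : ⊥ ≤ v)).choose_spec h

theorem vertexPoly_tail (e : HasseEdge P) :
    vertexPoly F e.tail = linPoly (edge F e) * vertexPoly F e.head := by
  rw [vertexPoly.eq_1 F e.head, ← edgePoly_cons]
  exact vertexPoly_eq F ⟨rfl, (exists_isPathBetween (bot_le : ⊥ ≤ e.head)).choose_spec⟩

theorem vertexPoly_eq_recPoly (v : P) :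
    vertexPoly F v = recPoly (grade ℕ v) (vertexCoeff F v) := by
  have := nontrivial_of_gradeOrder F (P := P)
  have h := (exists_isPathBetween (bot_le : ⊥ ≤ v)).choose_spec
  have hd : (vertexPoly F v).natDegree = grade ℕ v := by
    rw [vertexPoly, edgePoly_natDegree, h.grade_eq, grade_bot]
    simp
  rw [← hd]
  exact (edgePoly_monic F _).eq_recPoly

theorem recPoly_vertexCoeff_tail (e : HasseEdge P) :
    recPoly (grade ℕ e.head + 1) (vertexCoeff F e.tail)
      = linPoly (edge F e) * recPoly (grade ℕ e.head) (vertexCoeff F e.head) := by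
  rw [← grade_tail_eq, ← vertexPoly_eq_recPoly, ← vertexPoly_eq_recPoly, vertexPoly_tail]

/-- Hence the vertex coefficients generate `A(P)`; the same formula defines `edgeOp`. -/
theorem edge_eq_vertexCoeff (e : HasseEdge P) :
    edge F e = vertexCoeff F e.tail (grade ℕ e.head)
      - shiftCoeff (vertexCoeff F e.head) (grade ℕ e.head) :=
  ((linPoly_mul_recPoly_eq_iff _ _ _ _).1 (recPoly_vertexCoeff_tail F e)).2

theorem isRecurrent_vertexCoeff_of_le {w v : P} (h : w ≤ v) {m : ℕ → SplittingAlgebra F P}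
    (hm : IsRecurrent (grade ℕ w) (vertexCoeff F w) m) :
    IsRecurrent (grade ℕ v) (vertexCoeff F v) m := by
  induction v using WellFoundedLT.induction with
  | _ v ih =>
  rcases h.eq_or_lt with rfl | h
  · exact hm
  · obtain ⟨u, hwu, huv⟩ := exists_le_covBy_of_lt h
    have := (ih u huv.lt hwu).of_recPoly_eq (recPoly_vertexCoeff_tail F ⟨v, u, huv⟩)
    rwa [← grade_tail_eq ⟨v, u, huv⟩] at this

theorem grade_orderIso (σ : P ≃o P) (v : P) : grade ℕ (σ v) = grade ℕ v := by
  have h := (exists_isPathBetween (bot_le : ⊥ ≤ v)).choose_spec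
  rw [(h.map σ).grade_eq, h.grade_eq, map_bot, List.length_map]

theorem mapHom_vertexCoeff (σ : P ≃o P) (v : P) (l : ℕ) :
    mapHom F σ (vertexCoeff F v l) = vertexCoeff F (σ v) l := by
  have h := (exists_isPathBetween (bot_le : ⊥ ≤ v)).choose_spec
  have h' := h.map σ
  rw [map_bot] at h'
  rw [vertexCoeff, vertexCoeff, vertexPoly_eq F h', vertexPoly, ← map_edgePoly, coeff_map, map_neg]
  rfl

end Vertex

/-! ### Homomorphisms out of `A(P)` from compatible vertex polynomials -/

section Lift

variable {B : Type*} [Ring B] [Algebra F B]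

theorem prod_mul_recPoly [GradeOrder ℕ P] {E : HasseEdge P → B} {f : P → ℕ → B}
    (hE : ∀ e, recPoly (grade ℕ e.tail) (f e.tail)
      = linPoly (E e) * recPoly (grade ℕ e.head) (f e.head))
    {v u : P} {l : List (HasseEdge P)} (h : IsPathBetween v u l) :
    (l.map fun e => linPoly (E e)).prod * recPoly (grade ℕ u) (f u)
      = recPoly (grade ℕ v) (f v) := by
  induction l generalizing v with
  | nil => cases h; simp
  | cons e l ih =>
    rw [List.map_cons, List.prod_cons, mul_assoc, ih h.2, ← hE, h.1]

theorem prod_linPoly_eq [GradeOrder ℕ P] {E : HasseEdge P → B} {f : P → ℕ → B}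
    (hE : ∀ e, recPoly (grade ℕ e.tail) (f e.tail)
      = linPoly (E e) * recPoly (grade ℕ e.head) (f e.head))
    {π₁ π₂ : HassePath P} (h : π₁.Equivalent π₂) :
    (π₁.edges.map fun e => linPoly (E e)).prod = (π₂.edges.map fun e => linPoly (E e)).prod := by
  have h₁ : IsPathBetween π₁.tail π₁.head π₁.edges := isPathBetween_of_isChain π₁.isChain π₁.ne_nil
  have h₂ : IsPathBetween π₂.tail π₂.head π₂.edges := isPathBetween_of_isChain π₂.isChain π₂.ne_nil
  rw [h.1, h.2] at h₁
  -- Multiplied on the right by the polynomial of the common head, both products give that of the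
  -- common tail; a monic factor can be cancelled.
  exact (monic_recPoly (grade ℕ π₂.head) (f π₂.head)).isRegular.right
    ((prod_mul_recPoly hE h₁).trans (prod_mul_recPoly hE h₂).symm)

/-- The algebra homomorphism from the splitting algebra given by a family of monic polynomials, one
for each vertex, and for each edge a linear left factor relating the polynomials of its ends. -/
def liftOfRecPoly [GradeOrder ℕ P] (E : HasseEdge P → B) (f : P → ℕ → B)
    (hE : ∀ e, recPoly (grade ℕ e.tail) (f e.tail)
      = linPoly (E e) * recPoly (grade ℕ e.head) (f e.head)) : SplittingAlgebra F P →ₐ[F] B :=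
  RingQuot.liftAlgHom F ⟨FreeAlgebra.lift F E, by
    rintro _ _ ⟨π₁, π₂, h, k⟩
    have key := prod_linPoly_eq hE h
    have h₁ := map_pathPoly F (FreeAlgebra.lift F E) π₁.edges
    have h₂ := map_pathPoly F (FreeAlgebra.lift F E) π₂.edges
    simp only [FreeAlgebra.lift_ι_apply] at h₁ h₂
    have := congrArg (fun p => p.coeff k) (h₁.trans (key.trans h₂.symm))
    simp only [coeff_map] at this
    exact this⟩

theorem liftOfRecPoly_vertexCoeff [Finite P] [OrderBot P] [GradeMinOrder ℕ P]
    (E : HasseEdge P → B) (f : P → ℕ → B)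
    (hE : ∀ e, recPoly (grade ℕ e.tail) (f e.tail)
      = linPoly (E e) * recPoly (grade ℕ e.head) (f e.head)) (v : P) {l : ℕ} (hl : l < grade ℕ v) :
    liftOfRecPoly F E f hE (vertexCoeff F v l) = f v l := by
  have h := (exists_isPathBetween (bot_le : ⊥ ≤ v)).choose_spec
  have hb : grade ℕ (⊥ : P) = 0 := grade_bot
  have hone : recPoly (grade ℕ (⊥ : P)) (f (⊥ : P)) = 1 := by
    rw [hb]
    simp [recPoly]
  have hedge : ∀ e, liftOfRecPoly F E f hE (edge F e) = E e := fun e => by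
    simp [liftOfRecPoly, edge]
  have h' : (vertexPoly F v).map (liftOfRecPoly F E f hE : SplittingAlgebra F P →+* B)
      = recPoly (grade ℕ v) (f v) := by
    rw [← prod_mul_recPoly hE h, vertexPoly, edgePoly, Polynomial.map_list_prod, List.map_map,
      hone, mul_one]
    congr 2
    funext e
    simp [hedge, linPoly]
  have := congrArg (fun p => p.coeff l) h'
  simp only [coeff_map, coeff_recPoly, if_neg hl.ne, if_pos hl, zero_sub] at this
  rw [vertexCoeff, map_neg, ← neg_neg (f v l), ← this]
  rfl

end Lift

end SplittingAlgebra

/-! ### The representation of the splitting algebra on the word module -/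

namespace SplittingAlgebra

open Polynomial

variable (F : Type*) [Field F] {P : Type*} [PartialOrder P] [Finite P] [OrderBot P]
  [GradeMinOrder ℕ P]

/-- The operator on the word module attached to an edge. -/
def edgeOp (e : HasseEdge P) : Module.End F (WordModule F (grade ℕ : P → ℕ)) :=
  wordOp F (grade ℕ) e.tail (grade ℕ e.head)
    - shiftCoeff (wordOp F (grade ℕ) e.head) (grade ℕ e.head)

omit [Finite P] [OrderBot P] in
-- For a fundamental solution of the head, of rank `k`, the term at `k + 1` is computed twice: by
-- the recurrence of the tail at index `0` and by that of the head at index `1`. Comparison gives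
-- the coefficient identities.
theorem recPoly_wordOp_tail (e : HasseEdge P) :
    recPoly (grade ℕ e.tail) (wordOp F (grade ℕ) e.tail)
      = linPoly (edgeOp F e) * recPoly (grade ℕ e.head) (wordOp F (grade ℕ) e.head) := by
  rw [grade_tail_eq, linPoly_mul_recPoly_eq_iff]
  refine ⟨fun l hl => LinearMap.ext fun y => ?_, rfl⟩
  set k := grade ℕ e.head with hk
  set f := wordOp F (grade ℕ) e.head with hf
  set g := wordOp F (grade ℕ) e.tail with hg
  have hrec : IsRecurrent k f fun p => fundSol k f l p • y := isRecurrent_fundSol k f l y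
  have hrec' := isRecurrent_wordOp_of_lt grade_strictMono e.covBy.lt hrec
  rw [grade_tail_eq, ← hk, ← hg] at hrec'
  have hsum : ∀ h : ℕ → Module.End F (WordModule F (grade ℕ : P → ℕ)),
      ∑ q ∈ Finset.range k, h q • fundSol k f l q • y = h l • y := by
    intro h
    rw [Finset.sum_eq_single l]
    · simp [fundSol_of_lt f l hl]
    · intro q hq hql
      simp [fundSol_of_lt f l (Finset.mem_range.1 hq), hql]
    · simp [hl]
  have h₁ := hrec' 0
  simp only [zero_add] at h₁
  rw [Finset.sum_range_succ, hsum, fundSol_self f hl] at h₁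
  have h₂ : fundSol k f l (1 + k) • y = ∑ q ∈ Finset.range k, f q • fundSol k f l (1 + q) • y :=
    hrec 1
  have h₃ : ∑ q ∈ Finset.range k, f q • fundSol k f l (1 + q) • y
      = ∑ q ∈ Finset.range (k + 1), shiftCoeff f q • fundSol k f l q • y := by
    rw [Finset.sum_range_succ', shiftCoeff, zero_smul, add_zero]
    refine Finset.sum_congr rfl fun q _ => ?_
    rw [shiftCoeff, add_comm 1 q]
  rw [h₃, Finset.sum_range_succ, hsum, fundSol_self f hl, add_comm 1 k, h₁] at h₂
  have h₄ : edgeOp F e = g k - shiftCoeff f k := rfl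
  rw [h₄, LinearMap.add_apply, Module.End.mul_apply, LinearMap.sub_apply]
  simp only [Module.End.smul_def] at h₂
  rw [← add_sub_assoc, h₂, add_sub_cancel_right]

/-- The representation of the splitting algebra on the word module. -/
def wordRep : SplittingAlgebra F P →ₐ[F] Module.End F (WordModule F (grade ℕ : P → ℕ)) :=
  liftOfRecPoly F (edgeOp F) (wordOp F (grade ℕ)) (recPoly_wordOp_tail F)

theorem wordRep_vertexCoeff (v : P) {l : ℕ} (hl : l < grade ℕ v) :
    wordRep F (vertexCoeff F v l) = wordOp F (grade ℕ) v l :=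
  liftOfRecPoly_vertexCoeff F _ _ _ v hl

/-- The product in the splitting algebra of the letters of a word. -/
def wordProd (L : List (P × ℕ)) : SplittingAlgebra F P :=
  (L.map fun a => vertexCoeff F a.1 a.2).prod

/-- The linear map sending the words to their products in the splitting algebra. -/
def wordMap : WordModule F (grade ℕ : P → ℕ) →ₗ[F] SplittingAlgebra F P :=
  liftWord (wordProd F)

theorem wordMap_wordVec {L : List (P × ℕ)} (hL : IsAdmissible (grade ℕ) L) :
    wordMap F (wordVec F (grade ℕ) L) = wordProd F L := liftWord_wordVec _ hL

omit [GradeMinOrder ℕ P] in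
theorem wordProd_cons (a : P × ℕ) (L : List (P × ℕ)) :
    wordProd F (a :: L) = vertexCoeff F a.1 a.2 * wordProd F L := by
  simp [wordProd]

theorem wordMap_consWord {k l : ℕ} (hkl : k < l) (v : P) (hl : l < grade ℕ v)
    {m : WordModule F (grade ℕ : P → ℕ)} (hm : m ∈ lowWords F (grade ℕ) k) :
    wordMap F (consWord F (grade ℕ) v l m) = vertexCoeff F v l * wordMap F m := by
  refine LinearMap.eqOn_span (f := (wordMap F).comp (consWord F (grade ℕ) v l))
    (g := (LinearMap.mulLeft F (vertexCoeff F v l)).comp (wordMap F)) ?_ hm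
  rintro _ ⟨L, ⟨hL, h⟩, rfl⟩
  simp only [LinearMap.comp_apply, LinearMap.mulLeft_apply]
  rw [wordMap_wordVec F hL, consWord, liftWord_wordVec _ hL, wordMap_wordVec, wordProd_cons]
  refine ⟨hl, fun b hb hb' => ?_, hL⟩
  have := h b hb
  omega

/-- The straightening rule defining `wordOp` is an identity in `A(P)`, because
`isRecurrent_vertexCoeff_of_le` supplies there the recurrence from which it was solved. -/
theorem wordMap_wordOp (v : P) {l : ℕ} (hl : l < grade ℕ v)
    (m : WordModule F (grade ℕ : P → ℕ)) :
    wordMap F (wordOp F (grade ℕ) v l m) = vertexCoeff F v l * wordMap F m := by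
  induction v using WellFoundedLT.induction generalizing l m with
  | _ v ih =>
  suffices h : (wordMap F).comp (wordOp F (grade ℕ) v l)
      = (LinearMap.mulLeft F (vertexCoeff F v l)).comp (wordMap F) from DFunLike.congr_fun h m
  refine wordModule_hom_ext fun L hL => ?_
  simp only [LinearMap.comp_apply, LinearMap.mulLeft_apply]
  clear m
  induction L generalizing l with
  | nil =>
    rw [wordOp_of_adm v l hL (by simp), wordMap_wordVec F hL, wordMap_wordVec, wordProd_cons]
    exact ⟨hl, by simp, hL⟩
  | cons a L ihL =>
    obtain ⟨u, j⟩ := a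
    by_cases h : u < v ∧ grade ℕ u = l
    swap
    · rw [wordOp_of_adm v l hL (by simpa using h), wordMap_wordVec F hL, wordMap_wordVec,
        wordProd_cons F (v, l)]
      exact ⟨hl, by simpa using h, hL⟩
    obtain ⟨huv, rfl⟩ := h
    have hj : j < grade ℕ u := hL.1
    set s : ℕ → WordModule F (grade ℕ : P → ℕ) := fun p =>
      fundSol (grade ℕ u) (wordOp F (grade ℕ) u) j p (wordVec F (grade ℕ) L) with hs
    have hrec : IsRecurrent (grade ℕ u) (wordOp F (grade ℕ) u) s :=
      isRecurrent_fundSol _ _ _ (wordVec F (grade ℕ) L)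
    have hrecA : IsRecurrent (grade ℕ u) (vertexCoeff F u) fun p => wordMap F (s p) := by
      intro p
      simp only [hrec p, map_sum, Module.End.smul_def]
      exact Finset.sum_congr rfl fun q hq => ih u huv (Finset.mem_range.1 hq) _
    have h₁ := isRecurrent_vertexCoeff_of_le F huv.le hrecA 0
    have hlow : ∑ q ∈ Finset.range (grade ℕ u), vertexCoeff F v q • wordMap F (s q)
        = vertexCoeff F v j * wordMap F (wordVec F (grade ℕ) L) := by
      rw [Finset.sum_eq_single j]
      · simp [hs, fundSol_of_lt _ j hj]
      · intro q hq hqj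
        simp [hs, fundSol_of_lt _ j (Finset.mem_range.1 hq), hqj]
      · simp [hj]
    have hself : s (grade ℕ u) = wordVec F (grade ℕ) ((u, j) :: L) := by
      simp only [hs]
      rw [fundSol_self _ hj, wordOp_of_adm u j hL.2.2 hL.2.1]
    simp only [zero_add] at h₁
    rw [← Finset.sum_range_add_sum_Ico _ hl.le, ← Finset.Ioo_insert_left hl,
      Finset.sum_insert (by simp), hlow, hself, smul_eq_mul] at h₁
    rw [wordOp_of_lt huv hL, map_sub, map_sub, map_sum, ihL (hj.trans hl) hL.2.2]
    change wordMap F (s _) - _ - _ = _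
    rw [h₁]
    have hhigh : ∑ p ∈ Finset.Ioo (grade ℕ u) (grade ℕ v), wordMap F (consWord F (grade ℕ) v p (s p))
        = ∑ p ∈ Finset.Ioo (grade ℕ u) (grade ℕ v), vertexCoeff F v p • wordMap F (s p) := by
      refine Finset.sum_congr rfl fun q hq => ?_
      rw [Finset.mem_Ioo] at hq
      exact wordMap_consWord F hq.1 v hq.2
        (fundSol_mem_lowWords (wordOp_mem_lowWords grade_strictMono u) j hq.1.le _)
    rw [← hhigh]
    abel

/-- Acting on the empty word, the letters of an admissible word are prepended one at a time and no
straightening occurs. -/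
theorem wordRep_wordProd {L : List (P × ℕ)} (hL : IsAdmissible (grade ℕ) L) :
    wordRep F (wordProd F L) (wordVec F (grade ℕ) []) = wordVec F (grade ℕ) L := by
  induction L with
  | nil => simp [wordProd]
  | cons a L ih =>
    rw [wordProd_cons, map_mul, Module.End.mul_apply, ih hL.2.2, wordRep_vertexCoeff F _ hL.1,
      wordOp_of_adm _ _ hL.2.2 hL.2.1]

theorem wordMap_injective : Function.Injective (wordMap F (P := P)) := by
  have h : ((LinearMap.applyₗ (wordVec F (grade ℕ : P → ℕ) [])).comp
      (wordRep F (P := P)).toLinearMap).comp (wordMap F) = LinearMap.id := by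
    refine wordModule_hom_ext fun L hL => ?_
    simpa [wordMap_wordVec F hL] using wordRep_wordProd F hL
  exact Function.LeftInverse.injective (g := fun a => wordRep F a (wordVec F (grade ℕ) []))
    (DFunLike.congr_fun h)

/-- The range is stable under left multiplication by edges and contains `1`, the image of the empty
word. -/
theorem wordMap_surjective : Function.Surjective (wordMap F (P := P)) := by
  have hedge : ∀ e : HasseEdge P, ∀ m, edge F e * wordMap F m ∈ LinearMap.range (wordMap F) := by
    intro e m
    rw [edge_eq_vertexCoeff, sub_mul]
    refine sub_mem ⟨_, wordMap_wordOp F e.tail (by rw [grade_tail_eq]; omega) m⟩ ?_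
    rcases hk : grade ℕ e.head with _ | k
    · simp [shiftCoeff]
    · exact ⟨_, wordMap_wordOp F e.head (by omega) m⟩
  have key : ∀ x : FreeAlgebra F (HasseEdge P), ∀ m,
      RingQuot.mkAlgHom F (SplittingRel F P) x * wordMap F m ∈ LinearMap.range (wordMap F) := by
    intro x
    induction x using FreeAlgebra.induction with
    | grade0 c =>
      intro m
      rw [AlgHom.commutes, ← Algebra.smul_def]
      exact ⟨c • m, map_smul _ _ _⟩
    | grade1 e => exact hedge e
    | mul a b ha hb =>
      intro m
      obtain ⟨m', hm'⟩ := hb m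
      rw [map_mul, mul_assoc, ← hm']
      exact ha m'
    | add a b ha hb =>
      intro m
      rw [map_add, add_mul]
      exact add_mem (ha m) (hb m)
  intro a
  obtain ⟨x, rfl⟩ := RingQuot.mkAlgHom_surjective F (SplittingRel F P) a
  have := key x (wordVec F (grade ℕ) [])
  rw [wordMap_wordVec F (by trivial : IsAdmissible (grade ℕ : P → ℕ) [])] at this
  simpa [wordProd] using this

/-- The products of the admissible words form a basis of the splitting algebra. -/
def wordBasis : Module.Basis (AdmissibleWord (grade ℕ : P → ℕ)) F (SplittingAlgebra F P) :=
  .ofRepr (LinearEquiv.ofBijective (wordMap F) ⟨wordMap_injective F, wordMap_surjective F⟩).symm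

theorem wordBasis_apply (x : AdmissibleWord (grade ℕ : P → ℕ)) :
    wordBasis F x = wordProd F x.1 := by
  rw [← wordMap_wordVec F x.2, wordVec_of_adm F _ x.2]
  rfl

end SplittingAlgebra

/-! ### Traces and homogeneous bases permuted by an automorphism -/

section PermutedBasis

variable {F A ι : Type*} [Field F] [Ring A] [Algebra F A] (𝒜 : ℕ → Submodule F A)
  [GradedAlgebra 𝒜] (b : Module.Basis ι F A) {d : ι → ℕ} (hb : ∀ x, b x ∈ 𝒜 (d x))

include hb in
theorem le_span_homogeneous_basis (i : ℕ) :
    𝒜 i ≤ Submodule.span F (b '' {x | d x = i}) := by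
  have key : ∀ a, GradedAlgebra.proj 𝒜 i a ∈ Submodule.span F (b '' {x | d x = i}) := by
    intro a
    have ha := b.mem_span a
    induction ha using Submodule.span_induction with
    | mem x h =>
      obtain ⟨x, rfl⟩ := h
      rw [GradedAlgebra.proj_apply]
      by_cases hx : d x = i
      · rw [DirectSum.decompose_of_mem_same 𝒜 (hx ▸ hb x)]
        exact Submodule.subset_span ⟨x, hx, rfl⟩
      · rw [DirectSum.decompose_of_mem_ne 𝒜 (hb x) hx]
        exact zero_mem _
    | zero => simp
    | add x y _ _ hx hy => rw [map_add]; exact add_mem hx hy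
    | smul c x _ hx => rw [map_smul]; exact Submodule.smul_mem _ _ hx
  intro a ha
  have := key a
  rwa [GradedAlgebra.proj_apply, DirectSum.decompose_of_mem_same 𝒜 ha] at this

/-- The basis of a graded piece given by a homogeneous basis. -/
def homogeneousBasis (i : ℕ) : Module.Basis {x // d x = i} F (𝒜 i) :=
  .mk (v := fun x => (⟨b x.1, by simpa only [x.2] using hb x.1⟩ : 𝒜 i))
    (.of_comp (𝒜 i).subtype
      (b.linearIndependent.comp (fun x : {x // d x = i} => x.1) Subtype.val_injective))
    (by
      rintro ⟨a, ha⟩ -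
      have h := le_span_homogeneous_basis 𝒜 b hb i ha
      have h' : a ∈ Submodule.map (𝒜 i).subtype (Submodule.span F (Set.range
          fun x : {x // d x = i} => (⟨b x.1, by simpa only [x.2] using hb x.1⟩ : 𝒜 i))) := by
        rw [Submodule.map_span, ← Set.range_comp]
        convert h using 2
        ext y
        simp
      obtain ⟨y, hy, rfl⟩ := h'
      exact hy)

theorem coe_homogeneousBasis (i : ℕ) (x : {x // d x = i}) :
    (homogeneousBasis 𝒜 b hb i x : A) = b x.1 := by
  simp [homogeneousBasis]

theorem LinearMap.trace_of_permutes_basis {M κ : Type*} [AddCommGroup M] [Module F M] [Finite κ]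
    (c : Module.Basis κ F M) (π : κ → κ) (f : M →ₗ[F] M) (hf : ∀ x, f (c x) = c (π x)) :
    LinearMap.trace F M f = (Nat.card {x // π x = x} : F) := by
  classical
  have := Fintype.ofFinite κ
  rw [LinearMap.trace_eq_matrix_trace F c, Matrix.trace]
  simp only [Matrix.diag_apply, LinearMap.toMatrix_apply, hf, Module.Basis.repr_self,
    Finsupp.single_apply]
  rw [Finset.sum_boole, Nat.card_eq_fintype_card, Fintype.card_subtype]

include hb in
theorem coeff_gradedTrace_of_permutes_basis (i : ℕ) [FiniteDimensional F (𝒜 i)] (σ : A ≃ₐ[F] A)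
    (hσ : ∀ i, ∀ a ∈ 𝒜 i, σ a ∈ 𝒜 i) (π : ι → ι) (hd : ∀ x, d (π x) = d x)
    (hπ : ∀ x, σ (b x) = b (π x)) :
    PowerSeries.coeff i (gradedTrace 𝒜 σ hσ) = (Nat.card {x // d x = i ∧ π x = x} : F) := by
  have := Module.Finite.finite_basis (homogeneousBasis 𝒜 b hb i)
  rw [gradedTrace, PowerSeries.coeff_mk,
    LinearMap.trace_of_permutes_basis (homogeneousBasis 𝒜 b hb i)
      (fun x => ⟨π x.1, (hd x.1).trans x.2⟩)]
  · congr 1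
    refine Nat.card_congr ((Equiv.subtypeEquivRight fun x => ?_).trans
      (Equiv.subtypeSubtypeEquivSubtypeInter (fun x => d x = i) fun x => π x = x))
    exact Subtype.ext_iff
  · intro x
    refine Subtype.ext ?_
    change σ (homogeneousBasis 𝒜 b hb i x : A) = _
    rw [coe_homogeneousBasis, coe_homogeneousBasis]
    exact hπ x.1

end PermutedBasis

/-! ### Degrees of words and the trace on the splitting algebra -/

section WordDegree

variable {P : Type*}

/-- The degree of a word, the letter `(v, l)` having degree `r v - l`. -/
def wordDegree (r : P → ℕ) (L : List (P × ℕ)) : ℕ := (L.map fun a => r a.1 - a.2).sum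

/-- The action on words of a map between the vertices. -/
def mapWord {Q : Type*} (f : Q → P) (L : List (Q × ℕ)) : List (P × ℕ) :=
  L.map (Prod.map f id)

theorem wordDegree_mapWord {Q : Type*} (f : Q → P) (r : P → ℕ) (L : List (Q × ℕ)) :
    wordDegree r (mapWord f L) = wordDegree (fun x => r (f x)) L := by
  simp [wordDegree, mapWord, Function.comp_def]

theorem isAdmissible_mapWord {Q : Type*} [PartialOrder P] [PartialOrder Q] (f : Q → P)
    (hf : ∀ x y, f x < f y ↔ x < y) (r : P → ℕ) (L : List (Q × ℕ)) :
    IsAdmissible r (mapWord f L) ↔ IsAdmissible (fun x => r (f x)) L := by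
  induction L with
  | nil => exact Iff.rfl
  | cons a L ih =>
    change _ ∧ _ ∧ IsAdmissible r (mapWord f L) ↔ _ ∧ _ ∧ _
    rw [ih]
    refine and_congr Iff.rfl (and_congr ?_ Iff.rfl)
    cases L <;> simp [hf]

theorem mapWord_eq_self_iff (f : P → P) (L : List (P × ℕ)) :
    mapWord f L = L ↔ ∀ a ∈ L, f a.1 = a.1 := by
  induction L with
  | nil => simp [mapWord]
  | cons a L ih =>
    simp only [mapWord] at ih
    simp only [mapWord, List.map_cons, List.cons.injEq, ih, List.forall_mem_cons]
    simp [Prod.ext_iff]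

end WordDegree

/-! ### Degrees of the basis words and the automorphism action on them -/

namespace SplittingAlgebra

variable (F : Type*) [Field F] {P : Type*} [PartialOrder P] [Finite P] [OrderBot P]
  [GradeMinOrder ℕ P]

theorem vertexCoeff_mem (v : P) {l : ℕ} (hl : l ≤ grade ℕ v) :
    vertexCoeff F v l ∈ gradedPiece F P (grade ℕ v - l) := by
  have h := (exists_isPathBetween (bot_le : ⊥ ≤ v)).choose_spec
  have hlen := h.grade_eq
  rw [(grade_bot : grade ℕ (⊥ : P) = ⊥), Nat.bot_eq_zero, zero_add] at hlen
  obtain ⟨a, ha⟩ := decomposeFree_coeff F _ l (grade ℕ v - l)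
    ((Nat.add_sub_cancel' hl).trans hlen)
  rw [vertexCoeff, vertexPoly, edgePoly_eq_map, Polynomial.coeff_map]
  refine neg_mem ?_
  change RingQuot.mkAlgHom F (SplittingRel F P) _ ∈ _
  rw [← coe_decomposeFree, ← ha, DirectSum.lof_eq_of, DirectSum.coeAlgHom_of]
  exact a.2

theorem wordProd_mem {L : List (P × ℕ)} (hL : IsAdmissible (grade ℕ) L) :
    wordProd F L ∈ gradedPiece F P (wordDegree (grade ℕ) L) := by
  induction L with
  | nil => exact SetLike.GradedOne.one_mem
  | cons a L ih =>
    rw [wordProd_cons, wordDegree, List.map_cons, List.sum_cons]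
    exact SetLike.GradedMul.mul_mem (vertexCoeff_mem F a.1 hL.1.le) (ih hL.2.2)

theorem mapHom_wordProd (σ : P ≃o P) (L : List (P × ℕ)) :
    mapHom F σ (wordProd F L) = wordProd F (mapWord σ L) := by
  induction L with
  | nil => simp [wordProd, mapWord]
  | cons a L ih =>
    rw [wordProd_cons, map_mul, ih, mapHom_vertexCoeff]
    exact (wordProd_cons F (σ a.1, a.2) _).symm

/-- The coefficients of the trace generating function count the admissible words in the letters
fixed by the automorphism. -/
theorem coeff_trace (σ : P ≃o P) (i : ℕ) :
    PowerSeries.coeff i (trace F σ) = (Nat.card {L : List (P × ℕ) //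
      (IsAdmissible (grade ℕ) L ∧ ∀ a ∈ L, σ a.1 = a.1) ∧ wordDegree (grade ℕ) L = i} : F) := by
  have hg : (fun v : P => grade ℕ (σ v)) = grade ℕ := funext (grade_orderIso σ)
  have hadm : ∀ L : List (P × ℕ), IsAdmissible (grade ℕ) L → IsAdmissible (grade ℕ) (mapWord σ L) :=
    fun L hL => (isAdmissible_mapWord σ (fun _ _ => σ.lt_iff_lt) _ L).2 (by rwa [hg])
  rw [trace, coeff_gradedTrace_of_permutes_basis (gradedPiece F P) (wordBasis F)
    (d := fun x => wordDegree (grade ℕ) x.1)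
    (fun x => by rw [wordBasis_apply]; exact wordProd_mem F x.2) i (mapEquiv F σ)
    (mapEquiv_mem_gradedPiece F σ) (fun x => ⟨mapWord σ x.1, hadm x.1 x.2⟩)
    (fun x => by rw [wordDegree_mapWord, hg])
    (fun x => by
      rw [wordBasis_apply, wordBasis_apply]
      exact mapHom_wordProd F σ x.1)]
  congr 1
  refine Nat.card_congr ((Equiv.subtypeEquivRight fun x => ?_).trans
    ((Equiv.subtypeSubtypeEquivSubtypeInter (IsAdmissible (grade ℕ))
      (fun L => wordDegree (grade ℕ) L = i ∧ mapWord σ L = L)).trans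
    (Equiv.subtypeEquivRight fun L => ?_)))
  · rw [Subtype.ext_iff]
  · rw [mapWord_eq_self_iff]
    tauto

end SplittingAlgebra

/-! ### Counting admissible words -/

section Counting

variable {Q : Type*} [PartialOrder Q] [Finite Q] (r : Q → ℕ)

omit [PartialOrder Q] [Finite Q] in
theorem wordDegree_cons (a : Q × ℕ) (L : List (Q × ℕ)) :
    wordDegree r (a :: L) = (r a.1 - a.2) + wordDegree r L := by
  simp [wordDegree]

/-- Each letter of an admissible word has positive degree, and finitely many letters exist, so
removing the first letter gives an induction on degree. -/
theorem finite_admissible (d : ℕ) : {L | IsAdmissible r L ∧ wordDegree r L = d}.Finite := by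
  induction d using Nat.strong_induction_on with
  | _ d ih =>
  refine (((Set.finite_singleton []).union (Set.finite_iUnion fun v : Q =>
    (Set.finite_lt_nat (r v)).biUnion fun l (hl : l < r v) =>
      (?_ : (List.cons (v, l) '' {L | IsAdmissible r L ∧ (r v - l) + wordDegree r L = d}).Finite)))).subset ?_
  · refine Set.Finite.image _ ?_
    by_cases hd : r v - l ≤ d
    · refine (ih (d - (r v - l)) (by omega)).subset fun L hL => ⟨hL.1, ?_⟩
      have := hL.2
      omega
    · convert Set.finite_empty
      ext L
      simp only [Set.mem_ofPred_eq, Set.mem_empty_iff_false, iff_false]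
      rintro ⟨-, h⟩
      omega
  · rintro (_ | ⟨⟨v, l⟩, L⟩) ⟨hL, hd⟩
    · exact Or.inl rfl
    · refine Or.inr (Set.mem_iUnion.2 ⟨v, Set.mem_biUnion (x := l) hL.1 ⟨L, ⟨hL.2.2, ?_⟩, rfl⟩⟩)
      rwa [wordDegree_cons] at hd

/-- The finite set of the admissible words of a given degree. -/
def admissibleWords (d : ℕ) : Finset (List (Q × ℕ)) := (finite_admissible r d).toFinset

theorem mem_admissibleWords {d : ℕ} {L : List (Q × ℕ)} :
    L ∈ admissibleWords r d ↔ IsAdmissible r L ∧ wordDegree r L = d := by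
  simp [admissibleWords]

variable (F : Type*) [Field F]

open Classical in
/-- The generating function of the admissible words with a given property. -/
def wordSeries (p : List (Q × ℕ) → Prop) : F⟦X⟧ :=
  PowerSeries.mk fun d => ∑ L ∈ admissibleWords r d, if p L then 1 else 0

theorem coeff_wordSeries (p : List (Q × ℕ) → Prop) [DecidablePred p] (d : ℕ) :
    PowerSeries.coeff d (wordSeries r F p) = ∑ L ∈ admissibleWords r d, if p L then 1 else 0 := by
  rw [wordSeries, PowerSeries.coeff_mk]
  congr!

theorem coeff_wordSeries_true (d : ℕ) : PowerSeries.coeff d (wordSeries r F fun _ => True)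
    = (Nat.card {L // IsAdmissible r L ∧ wordDegree r L = d} : F) := by
  rw [coeff_wordSeries, if_pos trivial, Finset.sum_const, nsmul_eq_mul, mul_one, admissibleWords,
    ← Set.ncard_eq_toFinset_card _ (finite_admissible r d)]
  rfl

open PowerSeries

theorem wordSeries_nil : wordSeries r F (fun L => L = []) = 1 := by
  classical
  ext d
  rw [coeff_wordSeries, coeff_one, Finset.sum_ite_eq']
  simp [mem_admissibleWords, IsAdmissible, wordDegree, eq_comm]

theorem wordSeries_true [Fintype Q] : wordSeries r F (fun _ => True)
    = 1 + ∑ v, wordSeries r F fun L => L.head?.map Prod.fst = some v := by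
  classical
  rw [← wordSeries_nil r F]
  ext d
  simp only [map_add, map_sum, coeff_wordSeries]
  rw [Finset.sum_comm, ← Finset.sum_add_distrib]
  refine Finset.sum_congr rfl fun L _ => ?_
  cases L <;> simp

/-- Separates the words that may follow the letter `(v, l)` from those that may not. -/
theorem wordSeries_true_eq_add [Fintype Q] [DecidableLT Q] (v : Q) (l : ℕ) :
    wordSeries r F (fun _ => True)
      = wordSeries r F (fun L => ∀ b ∈ L.head?, ¬ (b.1 < v ∧ r b.1 = l))
        + ∑ w with w < v ∧ r w = l, wordSeries r F fun L => L.head?.map Prod.fst = some w := by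
  classical
  ext d
  simp only [map_add, map_sum, coeff_wordSeries]
  rw [Finset.sum_comm, ← Finset.sum_add_distrib]
  refine Finset.sum_congr rfl fun L _ => ?_
  rcases L with _ | ⟨a, L⟩
  · simp
  · by_cases h : a.1 < v ∧ r a.1 = l <;> simp [h]

theorem wordSeries_head (v : Q) :
    (wordSeries r F fun L => L.head?.map Prod.fst = some v) = ∑ l ∈ Finset.range (r v),
      X ^ (r v - l) * wordSeries r F (fun L => ∀ b ∈ L.head?, ¬ (b.1 < v ∧ r b.1 = l)) := by
  classical
  ext d
  simp only [map_sum, coeff_X_pow_mul', coeff_wordSeries]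
  simp only [← Finset.sum_filter]
  rw [Finset.sum_sigma']
  symm
  refine Finset.sum_nbij (fun x => (v, x.1) :: x.2) ?_ ?_ ?_ fun _ _ => rfl
  · rintro ⟨l, L⟩ hx
    simp only [Finset.mem_sigma, Finset.mem_filter, Finset.mem_range, mem_admissibleWords] at hx ⊢
    obtain ⟨⟨h₁, h₂⟩, ⟨h₃, h₄⟩, h₅⟩ := hx
    refine ⟨⟨⟨h₁, h₅, h₃⟩, ?_⟩, by simp⟩
    rw [wordDegree_cons, h₄]
    exact Nat.add_sub_cancel' h₂
  · rintro ⟨l, L⟩ - ⟨l', L'⟩ - h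
    simp only [List.cons.injEq, Prod.mk.injEq, true_and] at h
    obtain ⟨rfl, rfl⟩ := h
    rfl
  · intro L hL
    simp only [Finset.coe_filter, Set.mem_ofPred_eq, mem_admissibleWords] at hL
    obtain ⟨⟨h₁, h₂⟩, h₃⟩ := hL
    rcases L with _ | ⟨⟨w, l⟩, L⟩
    · simp at h₃
    obtain rfl : w = v := by simpa using h₃
    rw [wordDegree_cons] at h₂
    refine ⟨⟨l, L⟩, ?_, rfl⟩
    simp only [Finset.coe_sigma, Set.mem_sigma_iff, Finset.mem_coe, Finset.mem_filter,
      Finset.mem_range, mem_admissibleWords]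
    refine ⟨⟨h₁.1, by dsimp only at h₂; omega⟩, ⟨h₁.2.2, by dsimp only at h₂; omega⟩, h₁.2.1⟩

theorem sum_wordSeries_head [Fintype Q] [DecidableLE Q] (hr : StrictMono r) (v : Q) :
    (1 - X) * ∑ w with w ≤ v, X ^ (r v - r w)
        * wordSeries r F (fun L => L.head?.map Prod.fst = some w)
      = X * (1 - X ^ r v) * wordSeries r F (fun _ => True) := by
  classical
  have h₁ : ∑ l ∈ Finset.range (r v), X ^ (r v - l) * wordSeries r F (fun _ => True)
      = (wordSeries r F fun L => L.head?.map Prod.fst = some v)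
        + ∑ w with w < v, X ^ (r v - r w)
          * wordSeries r F (fun L => L.head?.map Prod.fst = some w) := by
    -- Each `w < v` is an obstruction for exactly one letter `(v, l)`, the one with `l = r w`; the
    -- sum over `w` is split accordingly.
    rw [wordSeries_head, ← Finset.sum_fiberwise_of_maps_to (s := Finset.univ.filter (· < v))
      (t := Finset.range (r v)) (g := r) (fun w hw => by simpa using hr (Finset.mem_filter.1 hw).2),
      ← Finset.sum_add_distrib]
    refine Finset.sum_congr rfl fun l _ => ?_
    rw [wordSeries_true_eq_add r F v l, mul_add, Finset.mul_sum, Finset.filter_filter]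
    congr 1
    refine Finset.sum_congr rfl fun w hw => ?_
    rw [(Finset.mem_filter.1 hw).2.2]
  have h₂ : ∑ w with w ≤ v, X ^ (r v - r w)
        * wordSeries r F (fun L => L.head?.map Prod.fst = some w)
      = ∑ l ∈ Finset.range (r v), X ^ (r v - l) * wordSeries r F (fun _ => True) := by
    rw [h₁]
    have : Finset.univ.filter (· ≤ v) = insert v (Finset.univ.filter (· < v)) := by
      ext w
      simp [le_iff_eq_or_lt]
    rw [this, Finset.sum_insert (by simp)]
    simp
  have h₃ : (1 - X) * ∑ l ∈ Finset.range (r v), (X : F⟦X⟧) ^ (r v - l) = X * (1 - X ^ r v) := by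
    rw [← Finset.sum_range_reflect, ← mul_neg_geom_sum (X : F⟦X⟧) (r v), ← mul_assoc, mul_comm X,
      mul_assoc, Finset.mul_sum (a := X)]
    congr 1
    refine Finset.sum_congr rfl fun l hl => ?_
    rw [← pow_succ']
    congr 1
    have := Finset.mem_range.1 hl
    omega
  rw [h₂, ← Finset.sum_mul, ← mul_assoc, h₃]

/-- The generating function of all admissible words, in terms of a family which is inverse to the
ranks. -/
theorem wordSeries_mul_eq [Fintype Q] [DecidableLE Q] [OrderBot Q] (hr : StrictMono r)
    (hbot : r ⊥ = 0) (g : Q → F⟦X⟧) (hg : ∀ w, ∑ v with w ≤ v, g v * X ^ (r v - r w) = 1) :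
    wordSeries r F (fun _ => True) * (1 - X * ∑ v, g v) = 1 - X := by
  set W := wordSeries r F (fun _ => True) with hW
  -- Weight the relation of `sum_wordSeries_head` at `v` by `g v` and sum over `v`. By `hg` each
  -- series with given first vertex receives total weight `1`, and together they make `W - 1`.
  have h₁ : (1 - X) * (W - 1) = ∑ v, g v * (X * (1 - X ^ r v) * W) := by
    simp only [hW, ← sum_wordSeries_head r F hr]
    rw [ wordSeries_true, add_sub_cancel_left]
    simp only [Finset.mul_sum, Finset.sum_filter]
    rw [Finset.sum_comm]
    refine Finset.sum_congr rfl fun w _ => ?_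
    rw [← mul_one (_ * _), ← hg w, Finset.sum_filter, Finset.mul_sum]
    refine Finset.sum_congr rfl fun v _ => ?_
    split_ifs
    · ring
    · simp
  have h₂ : ∑ v, g v * X ^ r v = 1 := by
    simpa [hbot] using hg ⊥
  have h₃ : ∑ v, g v * (X * (1 - X ^ r v) * W) = X * W * (∑ v, g v - ∑ v, g v * X ^ r v) := by
    rw [← Finset.sum_sub_distrib, Finset.mul_sum]
    refine Finset.sum_congr rfl fun v _ => ?_
    ring
  rw [h₃, h₂] at h₁
  linear_combination h₁

end Counting

/-! ### The lattice of subsets of a weighted set -/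

section WeightedSubsets

open PowerSeries

variable {C : Type*} [Fintype C] [DecidableEq C] (wt : C → ℕ) (F : Type*) [Field F]

/-- With `g S = ∏_{c ∉ S} (1 - X ^ wt c)`, the inversion condition at `T` is the expansion of `∏_{c
∉ T} (X ^ wt c + (1 - X ^ wt c)) = 1`, where the factors `X ^ wt c` are chosen on `S \ T`. -/
theorem wordSeries_finset (hwt : ∀ c, 0 < wt c) :
    wordSeries (fun S : Finset C => ∑ c ∈ S, wt c) F (fun _ => True)
      * (1 - X * ∏ c, (2 - X ^ wt c)) = 1 - X := by
  have hr : StrictMono fun S : Finset C => ∑ c ∈ S, wt c := fun S T h =>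
    Finset.sum_lt_sum_of_subset h.1 (Finset.exists_of_ssubset h).choose_spec.1
      (Finset.exists_of_ssubset h).choose_spec.2 (hwt _) fun _ _ _ => Nat.zero_le _
  have hsum : ∏ c, (2 - X ^ wt c : F⟦X⟧) = ∑ S : Finset C, ∏ c ∈ Sᶜ, (1 - X ^ wt c) := by
    have : ∀ c, (2 - X ^ wt c : F⟦X⟧) = 1 + (1 - X ^ wt c) := fun c => by ring
    simp only [this, Finset.prod_add, Finset.prod_const_one, one_mul, Finset.powerset_univ,
      Finset.compl_eq_univ_sdiff]
  rw [hsum]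
  refine wordSeries_mul_eq _ F hr (by simp) _ fun T => ?_
  have h := Finset.prod_add (fun c => (X : F⟦X⟧) ^ wt c) (fun c => 1 - X ^ wt c) Tᶜ
  simp only [add_sub_cancel, Finset.prod_const_one] at h
  refine Eq.trans ?_ h.symm
  refine Finset.sum_nbij' (fun S => S \ T) (fun U => T ∪ U) ?_ ?_ ?_ ?_ ?_
  · intro S _
    simp [Finset.subset_iff]
  · intro U _
    simp
  · intro S hS
    exact Finset.union_sdiff_of_subset (Finset.mem_filter.1 hS).2
  · intro U hU
    have hd : Disjoint T U := by
      rw [Finset.mem_powerset] at hU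
      exact (Finset.subset_compl_iff_disjoint_left.1 hU)
    exact hd.sup_sdiff_cancel_left
  · intro S hS
    have hTS : T ⊆ S := (Finset.mem_filter.1 hS).2
    rw [mul_comm, Finset.prod_pow_eq_pow_sum]
    congr 1
    · rw [← Finset.sum_sdiff hTS, Nat.add_sub_cancel]
    · congr 1
      ext c
      have := @hTS c
      simp only [Finset.mem_compl, Finset.mem_sdiff]
      tauto

end WeightedSubsets

/-! ### Cycles of a permutation -/

section Cycles

/-- The set of all cycles of a permutation, including the fixed points. -/
abbrev CycleClass {α : Type*} (τ : Equiv.Perm α) : Type _ :=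
  Quotient (Equiv.Perm.SameCycle.setoid τ)

/-- The number of elements of a cycle. -/
def cycleCard {α : Type*} {τ : Equiv.Perm α} (c : CycleClass τ) : ℕ :=
  Nat.card {a : α // (⟦a⟧ : CycleClass τ) = c}

theorem cycleCard_pos {α : Type*} [Finite α] {τ : Equiv.Perm α} (c : CycleClass τ) :
    0 < cycleCard c := by
  have : Nonempty {a : α // (⟦a⟧ : CycleClass τ) = c} := ⟨c.out, c.out_eq⟩
  exact Nat.card_pos

open Classical in
-- The classes whose representative is moved correspond to the nontrivial cycle factors, the others
-- to the fixed points, which contribute the parts `1`.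
theorem prod_map_cycleLengths {α M : Type*} [Finite α] [CommMonoid M] (τ : Equiv.Perm α)
    [Fintype (CycleClass τ)] (g : ℕ → M) :
    ((cycleLengths τ).map g).prod = ∏ c : CycleClass τ, g (cycleCard c) := by
  let _ := Fintype.ofFinite α
  have hlen : cycleLengths τ
      = τ.cycleFactorsFinset.1.map (fun f => f.support.card)
        + Multiset.replicate (τ.supportᶜ).card 1 := by
    rw [cycleLengths, Equiv.Perm.parts_partition, Finset.card_compl]
    rfl
  have hout : ∀ {c : CycleClass τ} {a : α}, (⟦a⟧ : CycleClass τ) = c ↔ τ.SameCycle c.out a := by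
    intro c a
    conv_lhs => rw [← c.out_eq]
    exact Quotient.eq.trans Equiv.Perm.sameCycle_comm
  rw [hlen, Multiset.map_add, Multiset.prod_add, Multiset.map_map, Multiset.map_replicate,
    Multiset.prod_replicate, ← Finset.prod_filter_mul_prod_filter_not Finset.univ
      (fun c : CycleClass τ => c.out ∈ τ.support)]
  congr 1
  · symm
    change _ = ∏ f ∈ τ.cycleFactorsFinset, g f.support.card
    refine Finset.prod_nbij (fun c => τ.cycleOf c.out) ?_ ?_ ?_ ?_
    · intro c hc
      exact Equiv.Perm.cycleOf_mem_cycleFactorsFinset_iff.2 (Finset.mem_filter.1 hc).2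
    · intro c hc c' hc' h
      have hm : c.out ∈ (τ.cycleOf c.out).support :=
        Equiv.Perm.mem_support_cycleOf_iff.2 ⟨.refl _ _, (Finset.mem_filter.1 hc).2⟩
      dsimp only at h
      rw [h] at hm
      rw [← c.out_eq]
      exact hout.2 (Equiv.Perm.mem_support_cycleOf_iff.1 hm).1
    · intro f hf
      obtain ⟨a, ha⟩ := (Equiv.Perm.mem_cycleFactorsFinset_iff.1 hf).1.nonempty_support
      have hfa : f = τ.cycleOf a := Equiv.Perm.cycle_is_cycleOf ha hf
      have hs : τ.SameCycle (⟦a⟧ : CycleClass τ).out a := hout.1 rfl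
      have ha' : a ∈ τ.support := Equiv.Perm.mem_cycleFactorsFinset_support_le hf ha
      refine ⟨⟦a⟧, ?_, ?_⟩
      · simpa [hs.apply_eq_self_iff] using ha'
      · dsimp only
        rw [hs.cycleOf_eq, hfa]
    · intro c hc
      congr 1
      rw [cycleCard, Nat.card_eq_fintype_card, Fintype.card_subtype]
      congr 1
      ext a
      have := (Finset.mem_filter.1 hc).2
      rw [Equiv.Perm.mem_support_cycleOf_iff, Finset.mem_filter, hout]
      simp only [Finset.mem_univ, true_and, this, and_true]
  · rw [← Finset.prod_const]
    symm
    have hfix : ∀ {a b : α}, a ∉ τ.support → τ.SameCycle a b → b = a := by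
      intro a b ha h
      exact (h.eq_of_left (by simpa [Function.IsFixedPt] using ha)).symm
    refine Finset.prod_nbij (fun c => c.out) ?_ ?_ ?_ ?_
    · intro c hc
      simpa using hc
    · intro c _ c' _ h
      dsimp only at h
      rw [← c.out_eq, ← c'.out_eq, h]
    · intro a ha
      have ha' : a ∉ τ.support := by simpa using ha
      have := hfix ha' (hout.1 rfl : τ.SameCycle (⟦a⟧ : CycleClass τ).out a).symm
      refine ⟨⟦a⟧, ?_, this⟩
      simpa [this] using ha'
    · intro c hc
      congr 1
      have hc' := (Finset.mem_filter.1 hc).2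
      rw [cycleCard, Nat.card_eq_one_iff_unique]
      refine ⟨⟨fun x y => Subtype.ext ?_⟩, ⟨c.out, c.out_eq⟩⟩
      rw [hfix hc' (hout.1 x.2), hfix hc' (hout.1 y.2)]

end Cycles

/-! ### Fixed elements of the lattice of subsets -/

section FixedSubsets

variable {n : ℕ} (σ : Finset (Fin n) ≃o Finset (Fin n))

/-- The atom given by an element. -/
def singletonAtom (i : Fin n) : {a : Finset (Fin n) // IsAtom a} := ⟨{i}, Finset.isAtom_singleton i⟩

theorem singletonAtom_bijective : Function.Bijective (singletonAtom (n := n)) := by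
  constructor
  · intro i j h
    simpa [singletonAtom] using h
  · rintro ⟨a, ha⟩
    obtain ⟨i, rfl⟩ := Finset.isAtom_iff.1 ha
    exact ⟨i, rfl⟩

/-- The cycle of an element. -/
def cycleClassOf (i : Fin n) : CycleClass (atomPerm σ) := ⟦singletonAtom i⟧

theorem cycleClassOf_surjective : Function.Surjective (cycleClassOf σ) := by
  intro c
  obtain ⟨a, rfl⟩ := Quotient.exists_rep c
  obtain ⟨i, rfl⟩ := singletonAtom_bijective.2 a
  exact ⟨i, rfl⟩

open Classical in
/-- The union of a set of cycles. -/
def cycleUnion (S : Finset (CycleClass (atomPerm σ))) : Finset (Fin n) :=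
  Finset.univ.filter fun i => cycleClassOf σ i ∈ S

theorem mem_cycleUnion {S : Finset (CycleClass (atomPerm σ))} {i : Fin n} :
    i ∈ cycleUnion σ S ↔ cycleClassOf σ i ∈ S := by
  simp [cycleUnion]

theorem cycleUnion_subset_iff (S T : Finset (CycleClass (atomPerm σ))) :
    cycleUnion σ S ⊆ cycleUnion σ T ↔ S ⊆ T := by
  refine ⟨fun h c hc => ?_, fun h i hi => ?_⟩
  · obtain ⟨i, rfl⟩ := cycleClassOf_surjective σ c
    exact (mem_cycleUnion σ).1 (h ((mem_cycleUnion σ).2 hc))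
  · exact (mem_cycleUnion σ).2 (h ((mem_cycleUnion σ).1 hi))

theorem cycleUnion_lt_iff (S T : Finset (CycleClass (atomPerm σ))) :
    cycleUnion σ S < cycleUnion σ T ↔ S < T := by
  rw [lt_iff_le_not_ge, lt_iff_le_not_ge]
  exact and_congr (cycleUnion_subset_iff σ S T) (not_congr (cycleUnion_subset_iff σ T S))

theorem cycleUnion_injective : Function.Injective (cycleUnion σ) := fun S T h =>
  Finset.Subset.antisymm ((cycleUnion_subset_iff σ S T).1 h.subset)
    ((cycleUnion_subset_iff σ T S).1 h.symm.subset)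

theorem card_cycleUnion (S : Finset (CycleClass (atomPerm σ))) :
    (cycleUnion σ S).card = ∑ c ∈ S, cycleCard c := by
  classical
  rw [Finset.card_eq_sum_card_fiberwise (f := cycleClassOf σ) (t := S)
    fun i hi => (mem_cycleUnion σ).1 hi]
  refine Finset.sum_congr rfl fun c hc => ?_
  rw [cycleCard, ← Nat.card_congr ((Equiv.ofBijective _ singletonAtom_bijective).subtypeEquiv
    (p := fun i => cycleClassOf σ i = c) fun _ => Iff.rfl), Nat.card_eq_fintype_card,
    Fintype.card_subtype]
  congr 1
  ext i
  simp only [Finset.mem_filter, Finset.mem_univ, true_and, mem_cycleUnion, and_iff_right_iff_imp]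
  rintro rfl
  exact hc

theorem apply_eq_self_of_cycleUnion (S : Finset (CycleClass (atomPerm σ))) :
    σ (cycleUnion σ S) = cycleUnion σ S := by
  -- The rank is the cardinality, which `σ` preserves, so one inclusion is enough.
  refine Finset.eq_of_subset_of_card_le (fun j hj => ?_)
    (SplittingAlgebra.grade_orderIso σ (cycleUnion σ S)).ge
  obtain ⟨i, hi⟩ := singletonAtom_bijective.2 ((atomPerm σ).symm (singletonAtom j))
  have hij : atomPerm σ (singletonAtom i) = singletonAtom j := by
    rw [hi, Equiv.apply_symm_apply]
  have hσ : σ {i} = {j} := congrArg Subtype.val hij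
  have hi' : i ∈ cycleUnion σ S := by
    rw [← Finset.singleton_subset_iff, ← σ.le_iff_le, hσ]
    simpa using hj
  have hclass : cycleClassOf σ i = cycleClassOf σ j :=
    Quotient.sound (⟨1, by simpa using hij⟩ : (atomPerm σ).SameCycle _ _)
  rw [mem_cycleUnion] at hi' ⊢
  rwa [← hclass]

/-- A fixed set containing a point contains its whole cycle, so it is the union of the cycles it
meets. -/
theorem exists_cycleUnion_eq {v : Finset (Fin n)} (hv : σ v = v) : ∃ S, cycleUnion σ S = v := by
  classical
  refine ⟨v.image (cycleClassOf σ), ?_⟩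
  ext i
  rw [mem_cycleUnion, Finset.mem_image]
  refine ⟨?_, fun hi => ⟨i, hi, rfl⟩⟩
  rintro ⟨j, hj, hji⟩
  obtain ⟨k, hk⟩ := (Quotient.exact hji : (atomPerm σ).SameCycle _ _).exists_nat_pow_eq
  have hpow : ∀ (k : ℕ), (((atomPerm σ) ^ k) (singletonAtom j)).1 ≤ v := by
    intro k
    induction k with
    | zero => simpa [singletonAtom] using hj
    | succ k ih =>
      rw [pow_succ', Equiv.Perm.mul_apply]
      change σ _ ≤ v
      rw [← hv]
      exact σ.monotone ih
  have := hpow k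
  rw [hk] at this
  simpa [singletonAtom] using this

/-- The words fixed by the automorphism correspond to the words on the sets of cycles. -/
theorem card_fixed_words (d : ℕ) :
    Nat.card {L : List (Finset (Fin n) × ℕ) //
      (IsAdmissible (grade ℕ) L ∧ ∀ a ∈ L, σ a.1 = a.1) ∧ wordDegree (grade ℕ) L = d}
      = Nat.card {L // IsAdmissible (fun S : Finset (CycleClass (atomPerm σ)) =>
          ∑ c ∈ S, cycleCard c) L ∧ wordDegree (fun S => ∑ c ∈ S, cycleCard c) L = d} := by
  have hg : (fun S => grade ℕ (cycleUnion σ S)) = fun S => ∑ c ∈ S, cycleCard c :=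
    funext (card_cycleUnion σ)
  have hadm : ∀ L, IsAdmissible (grade ℕ) (mapWord (cycleUnion σ) L)
      ↔ IsAdmissible (fun S => ∑ c ∈ S, cycleCard c) L := fun L => by
    rw [isAdmissible_mapWord _ (cycleUnion_lt_iff σ), hg]
  have hdeg : ∀ L, wordDegree (grade ℕ) (mapWord (cycleUnion σ) L)
      = wordDegree (fun S => ∑ c ∈ S, cycleCard c) L := fun L => by
    rw [wordDegree_mapWord, hg]
  symm
  refine Nat.card_congr (Equiv.ofBijective (fun L => ⟨mapWord (cycleUnion σ) L.1,
    ⟨(hadm L.1).2 L.2.1, ?_⟩, (hdeg L.1).trans L.2.2⟩) ⟨?_, ?_⟩)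
  · intro a ha
    obtain ⟨b, -, rfl⟩ := List.mem_map.1 ha
    exact apply_eq_self_of_cycleUnion σ b.1
  · intro L L' h
    refine Subtype.ext ?_
    exact List.map_injective_iff.2 ((cycleUnion_injective σ).prodMap Function.injective_id)
      (congrArg Subtype.val h)
  · rintro ⟨L, ⟨hL, hfix⟩, hd⟩
    -- `Function.invFun` inverts `cycleUnion` only on its range, which contains every letter of `L`
    -- because those letters are fixed.
    have hL' : mapWord (cycleUnion σ) (mapWord (Function.invFun (cycleUnion σ)) L) = L := by
      have : mapWord (cycleUnion σ) (mapWord (Function.invFun (cycleUnion σ)) L)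
          = mapWord (cycleUnion σ ∘ Function.invFun (cycleUnion σ)) L := by
        simp [mapWord, Function.comp_def]
      rw [this, mapWord_eq_self_iff]
      exact fun a ha => Function.invFun_eq (exists_cycleUnion_eq σ (hfix a ha))
    refine ⟨⟨mapWord (Function.invFun (cycleUnion σ)) L, ?_, ?_⟩, Subtype.ext hL'⟩
    · rw [← hadm, hL']
      exact hL
    · rw [← hdeg, hL']
      exact hd

end FixedSubsets

end

theorem mainTheorem9 (F : Type*) [Field F] (n : ℕ)
    (σ : Finset (Fin n) ≃o Finset (Fin n)) :
    SplittingAlgebra.trace F σ =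
      (1 - PowerSeries.X) *
        (1 - PowerSeries.X *
          ((cycleLengths (atomPerm σ)).map
            fun i => (2 - PowerSeries.X ^ i : PowerSeries F)).prod)⁻¹ := by
  classical
  have := Fintype.ofFinite (CycleClass (atomPerm σ))
  have h : SplittingAlgebra.trace F σ = wordSeries
      (fun S : Finset (CycleClass (atomPerm σ)) => ∑ c ∈ S, cycleCard c) F fun _ => True := by
    ext d
    rw [SplittingAlgebra.coeff_trace, card_fixed_words, coeff_wordSeries_true]
  -- The denominator has constant coefficient `1`, so its power series inverse is a true inverse.
  rw [PowerSeries.eq_mul_inv_iff_mul_eq (by simp), prod_map_cycleLengths, h]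
  exact wordSeries_finset cycleCard F cycleCard_pos
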